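/- Let $n\ge 1$ and let $Y_n=Y(\mathfrak{gl}_n)$ be the Yangian over $\mathbb C$, i.e. the associative unital $\mathbb C$-algebra on generators $T_{i,j}^{(r)}$ ($1\le i,j\le n$, $r\ge 1$) subject to the relations $$[T_{i,j}^{(r)},T_{h,k}^{(s)}]=\sum_{t=0}^{\min(r,s)-1}\left(T_{i,k}^{(r+s-1-t)}T_{h,j}^{(t)}-T_{i,k}^{(t)}T_{h,j}^{(r+s-1-t)}\right),$$ where $T_{i,j}^{(0)}:=\delta_{i,j}$. Let $T(u)$ be the $n\times n$ matrix over $Y_n[[u^{-1}]]$ with entries $T_{i,j}(u)=\sum_{r\ge 0}T_{i,j}^{(r)}u^{-r}$, and let $T(u)=F(u)D(u)E(u)$ be its (unique) Gauss factorization, with $F(u)$ lower unitriangular, $E(u)$ upper unitriangular and $D(u)=\operatorname{diag}(D_1(u),\dots,D_n(u))$. Put $$C_n(u)=\sum_{r\ge 0}C_n^{(r)}u^{-r}:=D_1(u)D_2(u-1)\cdots D_n(u-n+1)\in Y_n[[u^{-1}]],$$ where $(u-c)^{-r}$ is expanded as a power series in $u^{-1}$. Then the elements $C_n^{(1)},C_n^{(2)},\dots$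 lie in the center $Z(Y_n)$ of $Y_n$, are algebraically independent over $\mathbb C$, and generate $Z(Y_n)$ as a $\mathbb C$-algebra. -/

import Mathlib

open scoped PowerSeries

/-! ### The Yangian of `gl_n` over `ℂ`

Indices run over `Fin n`, that is over `0, …, n - 1` instead of `1, …, n`. -/

/-- The symbol `T_{i,j}^{(r)}` in the free algebra on the letters `T_{i,j}^{(r)}`, `r ≥ 1`
(the letter `(i, j, r)` stands for `T_{i,j}^{(r+1)}`); by convention `T_{i,j}^{(0)} = δ_{i,j}`. -/
noncomputable def yangianGen (n : ℕ) (i j : Fin n) : ℕ → FreeAlgebra ℂ (Fin n × Fin n × ℕ)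
  | 0 => if i = j then 1 else 0
  | r + 1 => FreeAlgebra.ι ℂ (i, j, r)

/-- The defining (RTT) relations of the Yangian, written in terms of coefficients:
`[T_{i,j}^{(r)}, T_{h,k}^{(s)}] =
  ∑_{t < min(r,s)} (T_{i,k}^{(r+s-1-t)} T_{h,j}^{(t)} - T_{i,k}^{(t)} T_{h,j}^{(r+s-1-t)})`.
The subtraction `r + s - 1 - t` never truncates, since `t < min r s`. -/
inductive YangianRel (n : ℕ) :
    FreeAlgebra ℂ (Fin n × Fin n × ℕ) → FreeAlgebra ℂ (Fin n × Fin n × ℕ) → Prop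
  | rtt (i j h k : Fin n) (r s : ℕ) : YangianRel n
      (yangianGen n i j r * yangianGen n h k s - yangianGen n h k s * yangianGen n i j r)
      (∑ t ∈ Finset.range (min r s),
        (yangianGen n i k (r + s - 1 - t) * yangianGen n h j t
          - yangianGen n i k t * yangianGen n h j (r + s - 1 - t)))

/-- The Yangian `Y_n = Y(gl_n)`: the associative unital `ℂ`-algebra on the generators
`T_{i,j}^{(r)}`, `r ≥ 1`, subject to the RTT relations. -/
abbrev Yangian (n : ℕ) : Type := RingQuot (YangianRel n)

namespace Yangian

/-- The element `T_{i,j}^{(r)}` of `Y_n`, for `r ≥ 0`. -/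
noncomputable def T (n : ℕ) (i j : Fin n) (r : ℕ) : Yangian n :=
  RingQuot.mkAlgHom ℂ (YangianRel n) (yangianGen n i j r)

/-- The matrix `T(u)` over `Y_n[[u⁻¹]]` with entries `T_{i,j}(u) = ∑_{r ≥ 0} T_{i,j}^{(r)} u^{-r}`.
The power series variable `X` stands for `u⁻¹`. -/
noncomputable def TMat (n : ℕ) : Matrix (Fin n) (Fin n) (Yangian n)⟦X⟧ :=
  Matrix.of fun i j => PowerSeries.mk (T n i j)

end Yangian

/-! ### Gauss factorization over power series with noncommuting coefficients -/

section Gauss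

/-- `M = F D E` with `F` lower unitriangular, `D = diag(d)` diagonal, `E` upper unitriangular. -/
structure IsGaussFactorization {S : Type*} [Ring S] {n : ℕ} (M F : Matrix (Fin n) (Fin n) S)
    (d : Fin n → S) (E : Matrix (Fin n) (Fin n) S) : Prop where
  lower : ∀ i j, i < j → F i j = 0
  lower_diag : ∀ i, F i i = 1
  upper : ∀ i j, j < i → E i j = 0
  upper_diag : ∀ i, E i i = 1
  eq : M = F * Matrix.diagonal d * E

/-- The result of the first `k` steps of Gaussian elimination on `M`: the step with pivot `p`
replaces `M_{i,j}` by `M_{i,j} - M_{i,p} M_{p,p}⁻¹ M_{p,j}`. -/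
noncomputable def gaussElim {R : Type*} [Ring R] {n : ℕ} (M : Matrix (Fin n) (Fin n) R⟦X⟧) :
    ℕ → Matrix (Fin n) (Fin n) R⟦X⟧
  | 0 => M
  | k + 1 => if hk : k < n then
      Matrix.of fun i j => gaussElim M k i j
        - gaussElim M k i ⟨k, hk⟩ * PowerSeries.invOfUnit (gaussElim M k ⟨k, hk⟩ ⟨k, hk⟩) 1
          * gaussElim M k ⟨k, hk⟩ j
    else gaussElim M k

/-- The `i`-th diagonal entry of the Gauss factorization of `M`, i.e. the quasi-determinant of the
top left `(i+1) × (i+1)` block of `M` (indices starting from `0`) with its last entry boxed. -/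
noncomputable def gaussDiag {R : Type*} [Ring R] {n : ℕ} (M : Matrix (Fin n) (Fin n) R⟦X⟧)
    (i : Fin n) : R⟦X⟧ :=
  gaussElim M i i i

variable {R : Type*} [Ring R] {n : ℕ} {M : Matrix (Fin n) (Fin n) R⟦X⟧}

theorem gaussElim_succ (k : Fin n) (i j : Fin n) :
    gaussElim M (k + 1) i j = gaussElim M k i j
      - gaussElim M k i k * PowerSeries.invOfUnit (gaussElim M k k k) 1 * gaussElim M k k j := by
  simp [gaussElim]

theorem gaussElim_invariant
    (hM : ∀ i j, PowerSeries.constantCoeff (M i j) = (1 : Matrix (Fin n) (Fin n) R) i j)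
    (k : ℕ) (hk : k ≤ n) :
    (∀ i j : Fin n, k ≤ (i : ℕ) → k ≤ (j : ℕ) →
      PowerSeries.constantCoeff (gaussElim M k i j) = (1 : Matrix (Fin n) (Fin n) R) i j) ∧
    (∀ i j : Fin n, (i : ℕ) < k ∨ (j : ℕ) < k → gaussElim M k i j = 0) := by
  induction k with
  | zero => exact ⟨fun i j _ _ => hM i j, fun i j h => by omega⟩
  | succ k ih =>
    obtain ⟨h1, h2⟩ := ih (by omega)
    set p : Fin n := ⟨k, hk⟩ with hp
    have hpk : (p : ℕ) = k := rfl
    have hs : ∀ i j, gaussElim M (k + 1) i j = gaussElim M k i j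
      - gaussElim M k i p * PowerSeries.invOfUnit (gaussElim M k p p) 1 * gaussElim M k p j :=
      fun i j => gaussElim_succ p i j
    have hpp : PowerSeries.constantCoeff (gaussElim M k p p) = ((1 : Rˣ) : R) := by
      rw [h1 p p le_rfl le_rfl]; simp
    refine ⟨fun i j hi hj => ?_, fun i j hij => ?_⟩
    · have hip : i ≠ p := fun h => by rw [h] at hi; omega
      rw [hs, map_sub, map_mul, map_mul, h1 i j (by omega) (by omega),
        h1 i p (by omega) le_rfl, Matrix.one_apply_ne hip]
      simp
    · rw [hs]
      rcases hij with hi | hj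
      · rcases Nat.lt_succ_iff_lt_or_eq.1 hi with hi | hi
        · rw [h2 i j (Or.inl hi), h2 i p (Or.inl hi)]; simp
        · have : i = p := Fin.ext hi
          rw [this, PowerSeries.mul_invOfUnit _ _ hpp]; simp
      · rcases Nat.lt_succ_iff_lt_or_eq.1 hj with hj | hj
        · rw [h2 i j (Or.inr hj), h2 p j (Or.inr hj)]; simp
        · have : j = p := Fin.ext hj
          rw [this, mul_assoc, PowerSeries.invOfUnit_mul _ _ hpp]; simp

theorem gaussDiag_constantCoeff
    (hM : ∀ i j, PowerSeries.constantCoeff (M i j) = (1 : Matrix (Fin n) (Fin n) R) i j)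
    (i : Fin n) : PowerSeries.constantCoeff (gaussDiag M i) = ((1 : Rˣ) : R) := by
  rw [gaussDiag, (gaussElim_invariant hM i i.2.le).1 i i le_rfl le_rfl]; simp

/-- A matrix over `R[[X]]` with constant term the identity has a Gauss factorization with diagonal
part `gaussDiag`. -/
theorem exists_gaussFactorization
    (hM : ∀ i j, PowerSeries.constantCoeff (M i j) = (1 : Matrix (Fin n) (Fin n) R) i j) :
    ∃ F E : Matrix (Fin n) (Fin n) R⟦X⟧, IsGaussFactorization M F (gaussDiag M) E := by
  have hd := gaussDiag_constantCoeff hM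
  refine ⟨Matrix.of fun i k => gaussElim M k i k * PowerSeries.invOfUnit (gaussDiag M k) 1,
    Matrix.of fun k j => PowerSeries.invOfUnit (gaussDiag M k) 1 * gaussElim M k k j, ?_, ?_, ?_, ?_, ?_⟩
  · intro i j hij
    simp [(gaussElim_invariant hM j j.2.le).2 i j (Or.inl hij)]
  · intro i
    exact PowerSeries.mul_invOfUnit _ _ (hd i)
  · intro i j hij
    simp [(gaussElim_invariant hM i i.2.le).2 i j (Or.inr hij)]
  · intro i
    exact PowerSeries.invOfUnit_mul _ _ (hd i)
  · ext1 i j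
    have hsum : (∑ k : Fin n, (gaussElim M k i j - gaussElim M (k + 1) i j)) = M i j := by
      rw [Fin.sum_univ_eq_sum_range (fun k => gaussElim M k i j - gaussElim M (k + 1) i j) n,
        Finset.sum_range_sub', (gaussElim_invariant hM n le_rfl).2 i j (Or.inl i.2)]
      simp [gaussElim]
    rw [← hsum, Matrix.mul_apply]
    refine Finset.sum_congr rfl fun k _ => ?_
    rw [Matrix.mul_diagonal, Matrix.of_apply, Matrix.of_apply, gaussElim_succ, sub_sub_cancel,
      mul_assoc (gaussElim M k i k) _ (gaussDiag M k), PowerSeries.invOfUnit_mul _ _ (hd k),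
      mul_one, mul_assoc]
    rfl

/-- The diagonal part of a Gauss factorization is unique. -/
theorem gaussFactorization_unique
    (hM : ∀ i j, PowerSeries.constantCoeff (M i j) = (1 : Matrix (Fin n) (Fin n) R) i j)
    {F E : Matrix (Fin n) (Fin n) R⟦X⟧} {d : Fin n → R⟦X⟧} (h : IsGaussFactorization M F d E) :
    d = gaussDiag M := by
  have hcol : ∀ (k : Fin n) (i : Fin n),
      (∑ l : Fin n, if (k : ℕ) ≤ l then F i l * d l * E l k else 0) = F i k * d k := by
    intro k i
    rw [Finset.sum_eq_single k]
    · simp [h.upper_diag]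
    · intro l _ hl
      split_ifs with hkl
      · rw [h.upper l k (lt_of_le_of_ne hkl hl.symm), mul_zero]
      · rfl
    · simp
  have hrow : ∀ (k : Fin n) (j : Fin n),
      (∑ l : Fin n, if (k : ℕ) ≤ l then F k l * d l * E l j else 0) = d k * E k j := by
    intro k j
    rw [Finset.sum_eq_single k]
    · simp [h.lower_diag]
    · intro l _ hl
      split_ifs with hkl
      · rw [h.lower k l (lt_of_le_of_ne hkl hl.symm), zero_mul, zero_mul]
      · rfl
    · simp
  have key : ∀ k : ℕ, k ≤ n → ∀ i j, gaussElim M k i j =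
      ∑ l : Fin n, if k ≤ (l : ℕ) then F i l * d l * E l j else 0 := by
    intro k
    induction k with
    | zero =>
      intro _ i j
      simp only [gaussElim, h.eq, Matrix.mul_apply (M := F * Matrix.diagonal d),
        Matrix.mul_diagonal, Nat.zero_le, if_true]
    | succ k ih =>
      intro hk i j
      have ih' := ih (by omega)
      set p : Fin n := ⟨k, hk⟩ with hp
      have e1 : ∀ i, gaussElim M k i p = F i p * d p := fun i => (ih' i p).trans (hcol p i)
      have e2 : ∀ j, gaussElim M k p j = d p * E p j := fun j => (ih' p j).trans (hrow p j)
      have e3 : gaussElim M k p p = d p := by rw [e1, h.lower_diag, one_mul]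
      have e4 : PowerSeries.constantCoeff (d p) = ((1 : Rˣ) : R) := by
        rw [← e3]; exact gaussDiag_constantCoeff hM p
      have hs : gaussElim M (k + 1) i j = gaussElim M k i j
        - gaussElim M k i p * PowerSeries.invOfUnit (gaussElim M k p p) 1 * gaussElim M k p j :=
        gaussElim_succ p i j
      rw [hs, e3, e1, e2, mul_assoc (F i p) (d p), PowerSeries.mul_invOfUnit _ _ e4, mul_one,
        ← mul_assoc, ih', sub_eq_iff_eq_add]
      rw [← Finset.add_sum_erase Finset.univ _ (Finset.mem_univ p),
        ← Finset.add_sum_erase Finset.univ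
          (fun l : Fin n => if k + 1 ≤ (l : ℕ) then F i l * d l * E l j else 0)
          (Finset.mem_univ p)]
      have hpk : (p : ℕ) = k := rfl
      simp only [hpk, le_refl, if_true, Nat.not_succ_le_self, if_false, zero_add]
      rw [add_comm]
      congr 1
      refine Finset.sum_congr rfl fun l hl => ?_
      have : (l : ℕ) ≠ k := fun e => (Finset.ne_of_mem_erase hl) (Fin.ext e)
      by_cases hkl : k ≤ (l : ℕ)
      · rw [if_pos hkl, if_pos (by omega)]
      · rw [if_neg hkl, if_neg (by omega)]
  funext i
  rw [gaussDiag, key i i.2.le, hcol, h.lower_diag, one_mul]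

end Gauss

/-! ### The series `C_n(u)` -/

namespace Yangian

theorem constantCoeff_TMat (n : ℕ) (i j : Fin n) :
    PowerSeries.constantCoeff (TMat n i j) = (1 : Matrix (Fin n) (Fin n) (Yangian n)) i j := by
  by_cases h : i = j <;> simp [TMat, T, yangianGen, Matrix.one_apply, h]

/-- The series `D_1(u), …, D_n(u)` in `Y_n[[u⁻¹]]`: `D n i` is the `i`-th diagonal entry
(`i = 0, …, n - 1`) of `D(u)` in the Gauss factorization `T(u) = F(u) D(u) E(u)`. -/
noncomputable def D (n : ℕ) (i : Fin n) : (Yangian n)⟦X⟧ :=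
  gaussDiag (TMat n) i

/-- `D(u)` is the diagonal part of the Gauss factorization of `T(u)`, which exists and whose
diagonal part is unique. -/
theorem gaussFactorization_iff (n : ℕ) (d : Fin n → (Yangian n)⟦X⟧) :
    (∃ F E : Matrix (Fin n) (Fin n) (Yangian n)⟦X⟧, IsGaussFactorization (TMat n) F d E) ↔
      d = D n := by
  constructor
  · rintro ⟨F, E, h⟩
    exact gaussFactorization_unique (constantCoeff_TMat n) h
  · rintro rfl
    exact exists_gaussFactorization (constantCoeff_TMat n)

/-- The substitution `f(u) ↦ f(u - c)` on `A[[u⁻¹]]`. With `X = u⁻¹` one has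
`(u - c)⁻¹ = X (1 - c X)⁻¹`, so that `f(u - c) = ∑_r f_r (X (1 - c X)⁻¹)^r`; the coefficient of
`X^m` only involves the terms with `r ≤ m`. -/
noncomputable def shift {A : Type*} [Ring A] [Algebra ℂ A] (c : ℂ) (f : A⟦X⟧) : A⟦X⟧ :=
  PowerSeries.mk fun m => ∑ r ∈ Finset.range (m + 1),
    PowerSeries.coeff m
      (((PowerSeries.X : ℂ⟦X⟧) * (1 - PowerSeries.C c * PowerSeries.X)⁻¹) ^ r)
      • PowerSeries.coeff r f

/-- `C_n(u) = D_1(u) D_2(u-1) ⋯ D_n(u-n+1)`, the product being taken in this order. -/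
noncomputable def CSeries (n : ℕ) : (Yangian n)⟦X⟧ :=
  (List.ofFn fun i : Fin n => shift ((i : ℕ) : ℂ) (D n i)).prod

/-- The coefficient `C_n^{(r)}` of `u^{-r}` in `C_n(u)`. -/
noncomputable def C (n r : ℕ) : Yangian n :=
  PowerSeries.coeff r (CSeries n)

end Yangian

/-! ### The RTT relation for a pair of matrices over a noncommutative ring -/

/-! Centrality. `Y_n` is generated by the coefficients of `T_{0,0}(u)` and the zero modes
`T_{k,k+1}^{(1)}`, `T_{k+1,k}^{(1)}` (`mem_subring_of_generators`), so only these need to commute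
with `C_n(u)`. The block surviving `k` elimination steps is the inverse of a block of `T(u)⁻¹`.
Inversion turns the RTT relation into its opposite and blocks inherit it, so the surviving block
satisfies the RTT relation again (`Pair.schur`). The series `T_{0,0}(u)` commutes with the entries
of `T(v)⁻¹` off the first row and column, hence with every `D_i(v)` (`commute_gaussDiag_zero`). A
zero mode with indices `k, k+1` commutes with the other `D_i`, while `D_k(u-k) D_{k+1}(u-k-1)` is a
`2 × 2` quantum minor of the surviving block, annihilated by the zero mode just as a determinant is
by a nilpotent matrix unit (`commute_shift_mul_shift`).

Generation. Give `T_{i,j}^{(r+1)}` loop degree `r`; to leading order the relations are those of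
`gl_n[x]`. No basis theorem is used. Instead, the coproduct followed by evaluation at a formal
parameter `x` is a homomorphism `Δ` from `Y_n` to matrices over `Y_n[x]`, sending `T_{i,j}^{(r+1)}`
to itself plus `e_{i,j} x^r` plus lower terms. The coefficients of `Δ(y) - y` therefore act as
partial derivatives of `y`, and `∑ T_{i,j}^{(s+1)} ∂_{i,j,s}` multiplies words of length `q` by `q`,
up to shorter words and lower degree (`LoopFiltration.euler_sub_mem`). If `y` commutes with all high
modes up to lower degree, applying `Δ` to the commutators and separating powers of `x` shows that
the derivatives of `y` have the same property, that the off-diagonal ones are negligible and that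
the diagonal ones agree. Since `C_n^{(s+1)}` has leading term `∑ T_{i,i}^{(s+1)}`, Euler's formula
becomes `q y ≡ ∑ C_n^{(s+1)} ∂_s y`. Induction on word length, then on loop degree, puts the center
into the algebra generated by the `C_n^{(r)}` (`exists_adjoin_of_almostCentral`,
`center_le_adjoin`).

Independence. Any series `g(u)` with constant term `1` over a commutative algebra gives a character
`T(u) ↦ g(u)·1`, under which `C_n(u) ↦ g(u) g(u-1) ⋯ g(u-n+1)`. As `n` is invertible, `g` can be
chosen so that the coefficients of this product are independent variables. -/

namespace RTT

section Legs

variable {ι B : Type*} [DecidableEq ι] [Ring B]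

/-- The matrix `P ⊗ 1`. -/
def legOne (P : Matrix ι ι B) : Matrix (ι × ι) (ι × ι) B :=
  Matrix.of fun p q => if p.2 = q.2 then P p.1 q.1 else 0

/-- The matrix `1 ⊗ P`. -/
def legTwo (P : Matrix ι ι B) : Matrix (ι × ι) (ι × ι) B :=
  Matrix.of fun p q => if p.1 = q.1 then P p.2 q.2 else 0

/-- The matrix `α - β · Π` with `Π` the permutation matrix of the swap. -/
def rMatrix (ι : Type*) [DecidableEq ι] (α β : B) : Matrix (ι × ι) (ι × ι) B :=
  Matrix.of fun p q => (if p = q then α else 0) - (if p = q.swap then β else 0)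

theorem legOne_one : legOne (1 : Matrix ι ι B) = 1 := by
  ext ⟨i, h⟩ ⟨j, k⟩
  by_cases hk : h = k <;> simp [legOne, Matrix.one_apply, hk]

theorem legTwo_one : legTwo (1 : Matrix ι ι B) = 1 := by
  ext ⟨i, h⟩ ⟨j, k⟩
  by_cases hk : i = j <;> simp [legTwo, Matrix.one_apply, hk]

variable [Fintype ι]

theorem legOne_mul (P Q : Matrix ι ι B) : legOne (P * Q) = legOne P * legOne Q := by
  ext ⟨i, h⟩ ⟨j, k⟩
  by_cases hk : h = k <;>
    simp [legOne, Matrix.mul_apply, Fintype.sum_prod_type, hk]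

theorem legTwo_mul (P Q : Matrix ι ι B) : legTwo (P * Q) = legTwo P * legTwo Q := by
  ext ⟨i, h⟩ ⟨j, k⟩
  by_cases hk : i = j <;>
    simp [legTwo, Matrix.mul_apply, Fintype.sum_prod_type, hk]

theorem legOne_mul_legTwo (P Q : Matrix ι ι B) (i h j k : ι) :
    (legOne P * legTwo Q) (i, h) (j, k) = P i j * Q h k := by
  simp [legOne, legTwo, Matrix.mul_apply, Fintype.sum_prod_type]

theorem legTwo_mul_legOne (P Q : Matrix ι ι B) (i h j k : ι) :
    (legTwo Q * legOne P) (i, h) (j, k) = Q h k * P i j := by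
  simp [legOne, legTwo, Matrix.mul_apply, Fintype.sum_prod_type]

theorem rMatrix_mul_apply (α β : B) (M : Matrix (ι × ι) (ι × ι) B) (i h : ι) (q : ι × ι) :
    (rMatrix ι α β * M) (i, h) q = α * M (i, h) q - β * M (h, i) q := by
  simp only [rMatrix, Matrix.mul_apply, Matrix.of_apply, sub_mul, Finset.sum_sub_distrib, ite_mul,
    zero_mul]
  congr 1
  · simp
  · rw [Finset.sum_eq_single (h, i)]
    · simp
    · rintro ⟨a, b⟩ - hab
      rw [if_neg]
      rintro h'
      simp only [Prod.swap_prod_mk, Prod.mk.injEq] at h'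
      exact hab (by rw [h'.1, h'.2])
    · simp

theorem mul_rMatrix_apply (α β : B) (M : Matrix (ι × ι) (ι × ι) B) (j k : ι) (p : ι × ι) :
    (M * rMatrix ι α β) p (j, k) = M p (j, k) * α - M p (k, j) * β := by
  simp only [rMatrix, Matrix.mul_apply, Matrix.of_apply, mul_sub, Finset.sum_sub_distrib, mul_ite,
    mul_zero]
  congr 1
  · simp
  · simp

end Legs

section Pair

variable {ι B : Type*} [Ring B]

/-- The relation `R P₁ Q₂ = Q₂ P₁ R` in terms of entries, `R = α - β Π`. -/
def Pair (α β : B) (P Q : Matrix ι ι B) : Prop :=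
  ∀ i j h k, α * (P i j * Q h k - Q h k * P i j) = β * (P h j * Q i k - Q h j * P i k)

/-- The relation `P₁ Q₂ R = R Q₂ P₁` in terms of entries, `R = α - β Π`. -/
def OpPair (α β : B) (P Q : Matrix ι ι B) : Prop :=
  ∀ i j h k, α * (P i j * Q h k - Q h k * P i j) = β * (P i k * Q h j - Q i k * P h j)

variable {α β : B}

theorem Pair.submatrix {κ : Type*} {P Q : Matrix ι ι B} (H : Pair α β P Q) (f : κ → ι) :
    Pair α β (P.submatrix f f) (Q.submatrix f f) := fun i j h k => H (f i) (f j) (f h) (f k)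

theorem OpPair.submatrix {κ : Type*} {P Q : Matrix ι ι B} (H : OpPair α β P Q) (f : κ → ι) :
    OpPair α β (P.submatrix f f) (Q.submatrix f f) := fun i j h k => H (f i) (f j) (f h) (f k)

theorem Pair.map {B' : Type*} [Ring B'] (f : B →+* B') (H : Pair α β P Q) :
    Pair (f α) (f β) (P.map f) (Q.map f) := by
  intro i j h k
  simpa using congrArg f (H i j h k)

variable [Fintype ι]

/-- The RTT relation is multiplicative for matrices with commuting entries. -/
theorem Pair.mul {P P' Q Q' : Matrix ι ι B} (hβ : ∀ b, Commute β b) (hα : ∀ b, Commute α b) (H : Pair α β P Q)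
    (H' : Pair α β P' Q') (h1 : ∀ i j h k, Commute (P i j) (Q' h k))
    (h2 : ∀ i j h k, Commute (Q i j) (P' h k)) : Pair α β (P * P') (Q * Q') := by
  intro i j h k
  have e1 : ∀ i j h k, (P * P') i j * (Q * Q') h k =
      ∑ a, ∑ b, P i a * Q h b * (P' a j * Q' b k) := by
    intro i j h k
    rw [Matrix.mul_apply, Matrix.mul_apply, Finset.sum_mul_sum]
    refine Finset.sum_congr rfl fun a _ => Finset.sum_congr rfl fun b _ => ?_
    simp only [mul_assoc]
    rw [← mul_assoc (Q h b), (h2 h b a j).eq, mul_assoc]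
  have e2 : ∀ i j h k, (Q * Q') h k * (P * P') i j =
      ∑ a, ∑ b, Q h b * P i a * (Q' b k * P' a j) := by
    intro i j h k
    rw [Matrix.mul_apply, Matrix.mul_apply, Finset.sum_mul_sum, Finset.sum_comm]
    refine Finset.sum_congr rfl fun a _ => Finset.sum_congr rfl fun b _ => ?_
    simp only [mul_assoc]
    rw [← mul_assoc (P i a), (h1 i a b k).eq, mul_assoc]
  -- Moving `R` past each factor leaves two intermediate sums which differ only by exchanging the
  -- summation indices, and so cancel.
  have e3 : ∑ a, ∑ b, Q h a * P i b * (P' a j * Q' b k) =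
      ∑ a, ∑ b, Q h b * P i a * (P' b j * Q' a k) := Finset.sum_comm
  have key : ∀ a b, α * (P i a * Q h b * (P' a j * Q' b k) - Q h b * P i a * (Q' b k * P' a j)) =
      β * (P h a * Q i b * (P' a j * Q' b k) - Q h a * P i b * (P' a j * Q' b k)) +
      β * (Q h b * P i a * (P' b j * Q' a k) - Q h b * P i a * (Q' b j * P' a k)) := by
    intro a b
    have a1 := congrArg (· * (P' a j * Q' b k)) (H i a h b)
    have a2 := congrArg (Q h b * P i a * ·) (H' a j b k)
    beta_reduce at a1 a2
    rw [← mul_assoc, ← (hα _).eq, ← mul_assoc (Q h b * P i a) β, ← (hβ _).eq] at a2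
    simp only [mul_sub, sub_mul, mul_assoc] at a1 a2 ⊢
    rw [← sub_eq_zero] at a1 a2 ⊢
    rw [← add_zero (0 : B)]
    nth_rewrite 1 [← a1]
    rw [← a2]
    abel
  rw [e1, e2, e1, e2]
  simp only [← Finset.sum_sub_distrib, Finset.mul_sum]
  simp only [key, Finset.sum_add_distrib]
  simp only [← Finset.mul_sum, Finset.sum_sub_distrib]
  rw [e3, ← mul_add]
  congr 1
  abel

variable [DecidableEq ι]

/-- The matrix form makes inversion formal, while the entrywise form makes passage to blocks formal.
-/
theorem pair_iff (hα : ∀ b, Commute α b) (hβ : ∀ b, Commute β b) {P Q : Matrix ι ι B} :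
    Pair α β P Q ↔
      rMatrix ι α β * (legOne P * legTwo Q) = legTwo Q * legOne P * rMatrix ι α β := by
  constructor
  · intro H
    ext ⟨i, h⟩ ⟨j, k⟩
    rw [rMatrix_mul_apply, mul_rMatrix_apply, legOne_mul_legTwo, legOne_mul_legTwo,
      legTwo_mul_legOne, legTwo_mul_legOne, ← (hα _).eq, ← (hβ _).eq]
    have := H i j h k
    rw [mul_sub, mul_sub] at this
    rw [← sub_eq_zero] at this ⊢
    rw [← this]
    abel
  · intro H i j h k
    have := congrFun (congrFun H (i, h)) (j, k)
    rw [rMatrix_mul_apply, mul_rMatrix_apply, legOne_mul_legTwo, legOne_mul_legTwo,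
      legTwo_mul_legOne, legTwo_mul_legOne, ← (hα _).eq, ← (hβ _).eq] at this
    rw [mul_sub, mul_sub]
    rw [← sub_eq_zero] at this ⊢
    rw [← this]
    abel

theorem opPair_iff (hα : ∀ b, Commute α b) (hβ : ∀ b, Commute β b) {P Q : Matrix ι ι B} :
    OpPair α β P Q ↔
      legOne P * legTwo Q * rMatrix ι α β = rMatrix ι α β * (legTwo Q * legOne P) := by
  constructor
  · intro H
    ext ⟨i, h⟩ ⟨j, k⟩
    rw [rMatrix_mul_apply, mul_rMatrix_apply, legOne_mul_legTwo, legOne_mul_legTwo,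
      legTwo_mul_legOne, legTwo_mul_legOne, ← (hα _).eq, ← (hβ _).eq]
    have := H i j h k
    rw [mul_sub, mul_sub] at this
    rw [← sub_eq_zero] at this ⊢
    rw [← this]
    abel
  · intro H i j h k
    have := congrFun (congrFun H (i, h)) (j, k)
    rw [rMatrix_mul_apply, mul_rMatrix_apply, legOne_mul_legTwo, legOne_mul_legTwo,
      legTwo_mul_legOne, legTwo_mul_legOne, ← (hα _).eq, ← (hβ _).eq] at this
    rw [mul_sub, mul_sub]
    rw [← sub_eq_zero] at this ⊢
    rw [← this]
    abel

variable {P P' Q Q' : Matrix ι ι B}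

theorem leg_mul_inv (hP : P * P' = 1) (hQ : Q * Q' = 1) :
    legOne P * legTwo Q * (legTwo Q' * legOne P') = 1 := by
  rw [mul_assoc, ← mul_assoc (legTwo Q), ← legTwo_mul, hQ, legTwo_one, one_mul, ← legOne_mul, hP,
    legOne_one]

theorem leg_mul_inv' (hP : P * P' = 1) (hQ : Q * Q' = 1) :
    legTwo Q * legOne P * (legOne P' * legTwo Q') = 1 := by
  rw [mul_assoc, ← mul_assoc (legOne P), ← legOne_mul, hP, legOne_one, one_mul, ← legTwo_mul, hQ,
    legTwo_one]

/-- Multiply `R P₁ Q₂ = Q₂ P₁ R` on the left by `(Q₂ P₁)⁻¹` and on the right by `(P₁ Q₂)⁻¹`. -/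
theorem Pair.inv (hα : ∀ b, Commute α b) (hβ : ∀ b, Commute β b) (H : Pair α β P Q)
    (hP : P * P' = 1) (hP' : P' * P = 1) (hQ : Q * Q' = 1) (hQ' : Q' * Q = 1) :
    OpPair α β P' Q' := by
  rw [opPair_iff hα hβ]
  rw [pair_iff hα hβ] at H
  calc _ = legOne P' * legTwo Q' * rMatrix ι α β *
        (legOne P * legTwo Q * (legTwo Q' * legOne P')) := by rw [leg_mul_inv hP hQ, mul_one]
    _ = legOne P' * legTwo Q' * (rMatrix ι α β * (legOne P * legTwo Q)) *
        (legTwo Q' * legOne P') := by simp only [mul_assoc]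
    _ = legOne P' * legTwo Q' * (legTwo Q * legOne P) * (rMatrix ι α β *
        (legTwo Q' * legOne P')) := by rw [H]; simp only [mul_assoc]
    _ = _ := by rw [leg_mul_inv hP' hQ', one_mul]

theorem OpPair.inv (hα : ∀ b, Commute α b) (hβ : ∀ b, Commute β b) (H : OpPair α β P Q)
    (hP : P * P' = 1) (hP' : P' * P = 1) (hQ : Q * Q' = 1) (hQ' : Q' * Q = 1) :
    Pair α β P' Q' := by
  rw [pair_iff hα hβ]
  rw [opPair_iff hα hβ] at H
  calc _ = (legTwo Q' * legOne P') * (legOne P * legTwo Q) * (rMatrix ι α β *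
        (legOne P' * legTwo Q')) := by rw [leg_mul_inv' hP' hQ', one_mul]
    _ = (legTwo Q' * legOne P') * (legOne P * legTwo Q * rMatrix ι α β) *
        (legOne P' * legTwo Q') := by simp only [mul_assoc]
    _ = legTwo Q' * legOne P' * rMatrix ι α β * (legTwo Q * legOne P *
        (legOne P' * legTwo Q')) := by rw [H]; simp only [mul_assoc]
    _ = _ := by rw [leg_mul_inv' hP hQ, mul_one]

/-- If `P, Q` satisfy the RTT relation, so do the inverses of the corresponding blocks of
`P⁻¹, Q⁻¹`. -/
theorem Pair.schur {κ : Type*} [Fintype κ] [DecidableEq κ] (hα : ∀ b, Commute α b)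
    (hβ : ∀ b, Commute β b) (H : Pair α β P Q)
    (hP : P * P' = 1) (hP' : P' * P = 1) (hQ : Q * Q' = 1) (hQ' : Q' * Q = 1) (f : κ → ι)
    {U V : Matrix κ κ B} (hU : U * P'.submatrix f f = 1) (hU' : P'.submatrix f f * U = 1)
    (hV : V * Q'.submatrix f f = 1) (hV' : Q'.submatrix f f * V = 1) : Pair α β U V :=
  ((H.inv hα hβ hP hP' hQ hQ').submatrix f).inv hα hβ hU' hU hV' hV

/-- An entry of `P` commutes with the entries of `Q⁻¹` in other rows and columns. -/
theorem Pair.commute_inv (hα : ∀ b, Commute α b) (hα0 : ∀ b, α * b = 0 → b = 0)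
    (hβ : ∀ b, Commute β b)
    (H : Pair α β P Q) (hQ : Q * Q' = 1) (hQ' : Q' * Q = 1) {i j h k : ι} (hik : i ≠ k)
    (hjh : j ≠ h) : Commute (P i j) (Q' h k) := by
  rw [pair_iff hα hβ] at H
  have e1 : legTwo Q' * legTwo Q = 1 := by rw [← legTwo_mul, hQ', legTwo_one]
  have e2 : legTwo Q * legTwo Q' = 1 := by rw [← legTwo_mul, hQ, legTwo_one]
  have H' : legTwo Q' * (rMatrix ι α β * legOne P) = legOne P * rMatrix ι α β * legTwo Q' := by
    calc _ = legTwo Q' * (rMatrix ι α β * (legOne P * legTwo Q)) * legTwo Q' := by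
          simp only [mul_assoc, e2, mul_one]
      _ = (legTwo Q' * legTwo Q) * legOne P * rMatrix ι α β * legTwo Q' := by
          rw [H]; simp only [mul_assoc]
      _ = _ := by rw [e1, one_mul]
  have H2 := congrFun (congrFun H' (i, h)) (j, k)
  -- In this entry the permutation part of `R` contributes only when `i = k`; on the other side it
  -- contributes only when `j = h`.
  have l : (legTwo Q' * (rMatrix ι α β * legOne P)) (i, h) (j, k) = Q' h k * (α * P i j) := by
    rw [Matrix.mul_apply, Fintype.sum_prod_type]
    simp [legTwo, rMatrix_mul_apply, legOne, mul_sub, hik]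
  have r : (legOne P * rMatrix ι α β * legTwo Q') (i, h) (j, k) = P i j * α * Q' h k := by
    rw [Matrix.mul_apply, Fintype.sum_prod_type]
    simp [legTwo, mul_rMatrix_apply, legOne, sub_mul, hjh.symm]
  rw [l, r, ← mul_assoc, ← (hα (Q' h k)).eq, ← (hα (P i j)).eq, mul_assoc, mul_assoc] at H2
  exact (sub_eq_zero.1 (hα0 _ (by rw [mul_sub, H2, sub_self])))

end Pair

end RTT

/-! ### Families satisfying the defining relations of the Yangian -/

/-- A family `t_{i,j}^{(r)}` with `t_{i,j}^{(0)} = δ_{i,j}` which satisfies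
`(u - v)[t_{i,j}(u), t_{h,k}(v)] = t_{h,j}(u) t_{i,k}(v) - t_{h,j}(v) t_{i,k}(u)`. -/
structure IsRTTFamily {A : Type*} [Ring A] {n : ℕ} (t : Fin n → Fin n → ℕ → A) : Prop where
  zero : ∀ i j, t i j 0 = if i = j then 1 else 0
  rtt : ∀ i j h k r s,
    (t i j (r + 1) * t h k s - t h k s * t i j (r + 1))
      - (t i j r * t h k (s + 1) - t h k (s + 1) * t i j r)
      = t h j r * t i k s - t h j s * t i k r

namespace IsRTTFamily

variable {A : Type*} [Ring A] {n : ℕ} {t : Fin n → Fin n → ℕ → A}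

/-- Both commutators on the left of `rtt` are sums whose superscripts add up to `r + s`, so their
difference is at most the one boundary term by which the ranges differ. The symmetry in `(r, s)`
then allows reordering the factors. -/
theorem of_sum (h0 : ∀ i j, t i j 0 = if i = j then 1 else 0)
    (H : ∀ i j h k r s, t i j r * t h k s - t h k s * t i j r =
      ∑ a ∈ Finset.range (min r s),
        (t i k (r + s - 1 - a) * t h j a - t i k a * t h j (r + s - 1 - a))) :
    IsRTTFamily t := by
  have symm : ∀ i j h k r s, t i j r * t h k s - t h k s * t i j r =
      t i j s * t h k r - t h k r * t i j s := by
    intro i j h k r s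
    rw [H, H, min_comm, add_comm r s]
  refine ⟨h0, fun i j h k r s => ?_⟩
  have e1 : t h j r * t i k s - t h j s * t i k r = t i k s * t h j r - t i k r * t h j s := by
    have := symm h j i k r s
    rw [← sub_eq_zero] at this ⊢
    rw [← this]
    abel
  rw [e1, H, H, show r + 1 + s - 1 = r + s by omega, show r + (s + 1) - 1 = r + s by omega]
  rcases lt_trichotomy r s with hrs | hrs | hrs
  · rw [min_eq_left (by omega), min_eq_left (by omega), Finset.sum_range_succ]
    simp
  · subst hrs
    rw [min_eq_right (by omega), min_eq_left (by omega)]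
    simp
  · rw [min_eq_right (by omega), min_eq_right (by omega), Finset.sum_range_succ]
    simp

theorem commutator_zero_left (ht : IsRTTFamily t) (i j h k : Fin n) (s : ℕ) :
    t i j 0 * t h k s - t h k s * t i j 0 = 0 := by
  rw [ht.zero]
  split_ifs <;> simp

theorem commutator_zero_right (ht : IsRTTFamily t) (i j h k : Fin n) (r : ℕ) :
    t i j r * t h k 0 - t h k 0 * t i j r = 0 := by
  rw [ht.zero]
  split_ifs <;> simp

/-- Iterating `rtt` moves the whole of `r` to the other superscript, until the first factor is a
scalar. -/
theorem commutator_eq_sum (ht : IsRTTFamily t) (i j h k : Fin n) (r s : ℕ) :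
    t i j r * t h k s - t h k s * t i j r =
      ∑ a ∈ Finset.range r, (t h j a * t i k (r + s - 1 - a) - t h j (r + s - 1 - a) * t i k a) := by
  induction r generalizing s with
  | zero => simpa using ht.commutator_zero_left i j h k s
  | succ r ih =>
    rw [sub_eq_iff_eq_add.1 (ht.rtt i j h k r s), ih (s + 1), Finset.sum_range_succ,
      show r + 1 + s - 1 = r + s by omega, show r + (s + 1) - 1 = r + s by omega,
      show r + s - r = s by omega, add_comm]

/-- The longer of the two sums has the extra terms `r ≤ a < s`, which cancel in pairs under `a ↦ r +
s - 1 - a`; a fixed point of this involution contributes zero. -/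
theorem commutator_symm (ht : IsRTTFamily t) (i j h k : Fin n) (r s : ℕ) :
    t i j r * t h k s - t h k s * t i j r = t i j s * t h k r - t h k r * t i j s := by
  wlog hrs : r ≤ s
  · exact (this ht i j h k s r (le_of_not_ge hrs)).symm
  rw [ht.commutator_eq_sum, ht.commutator_eq_sum i j h k s r, add_comm s r,
    ← Finset.sum_range_add_sum_Ico _ hrs, left_eq_add]
  refine Finset.sum_involution (fun a _ => r + s - 1 - a) ?_ ?_ ?_ ?_
  · intro a ha
    have := Finset.mem_Ico.1 ha
    rw [show r + s - 1 - (r + s - 1 - a) = a by omega]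
    abel
  · intro a ha h0 h1
    rw [h1, sub_self] at h0
    exact h0 rfl
  · intro a ha
    have := Finset.mem_Ico.1 ha
    exact Finset.mem_Ico.2 (by omega)
  · intro a ha
    have := Finset.mem_Ico.1 ha
    omega

theorem commutator_eq_sum_min (ht : IsRTTFamily t) (i j h k : Fin n) (r s : ℕ) :
    t i j r * t h k s - t h k s * t i j r =
      ∑ a ∈ Finset.range (min r s),
        (t i k (r + s - 1 - a) * t h j a - t i k a * t h j (r + s - 1 - a)) := by
  wlog hrs : r ≤ s
  · rw [ht.commutator_symm, this ht i j h k s r (le_of_not_ge hrs), min_comm, add_comm]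
  rw [ht.commutator_eq_sum, min_eq_left hrs]
  refine Finset.sum_congr rfl fun a _ => ?_
  -- The order of the factors in each summand is exchanged by the symmetry of commutators in the two
  -- superscripts.
  have := ht.commutator_symm h j i k a (r + s - 1 - a)
  rw [← sub_eq_zero] at this ⊢
  rw [← this]
  abel

/-- The coefficients `t_{i,i}^{(r)}` with fixed `i` commute. -/
theorem commute_diag (ht : IsRTTFamily t) (i : Fin n) (r s : ℕ) : Commute (t i i r) (t i i s) := by
  suffices ∀ m r s, min r s ≤ m → t i i r * t i i s - t i i s * t i i r = 0 from
    sub_eq_zero.1 (this _ r s le_rfl)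
  intro m
  induction m with
  | zero =>
    intro r s hrs
    rw [ht.commutator_eq_sum_min, Nat.le_zero.1 hrs]
    simp
  | succ m ih =>
    intro r s hrs
    rw [ht.commutator_eq_sum_min]
    -- Each summand is again a commutator of diagonal coefficients, with smaller minimum `a`.
    refine Finset.sum_eq_zero fun a ha => ih _ _ ?_
    have := Finset.mem_range.1 ha
    omega

/-- The action of the zero modes. -/
theorem commutator_one (ht : IsRTTFamily t) (i j h k : Fin n) (s : ℕ) :
    t i j 1 * t h k s - t h k s * t i j 1 =
      (if h = j then t i k s else 0) - (if i = k then t h j s else 0) := by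
  rw [ht.commutator_eq_sum i j h k 1 s]
  simp only [Finset.range_one, Finset.sum_singleton, ht.zero]
  simp only [Nat.sub_zero, Nat.add_sub_cancel_left]
  split_ifs <;> simp

end IsRTTFamily

/-! ### Generating series in two variables. -/

namespace RTT

variable {A : Type*} [Ring A] {n : ℕ}

/-- The matrix of generating series of a family. -/
noncomputable def seriesMatrix (t : Fin n → Fin n → ℕ → A) : Matrix (Fin n) (Fin n) A⟦X⟧ :=
  Matrix.of fun i j => PowerSeries.mk (t i j)

/-- The variable `u⁻¹` in `A[[u⁻¹]][[v⁻¹]]`. -/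
noncomputable def xVar (A : Type*) [Ring A] : A⟦X⟧⟦X⟧ := PowerSeries.C PowerSeries.X

/-- The variable `v⁻¹` in `A[[u⁻¹]][[v⁻¹]]`. -/
noncomputable def yVar (A : Type*) [Ring A] : A⟦X⟧⟦X⟧ := PowerSeries.X

/-- The inclusion `f(u) ↦ f(u)` of `A[[u⁻¹]]` into `A[[u⁻¹]][[v⁻¹]]`. -/
noncomputable def inU (A : Type*) [Ring A] : A⟦X⟧ →+* A⟦X⟧⟦X⟧ := PowerSeries.C

/-- The inclusion `f(u) ↦ f(v)` of `A[[u⁻¹]]` into `A[[u⁻¹]][[v⁻¹]]`. -/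
noncomputable def inV (A : Type*) [Ring A] : A⟦X⟧ →+* A⟦X⟧⟦X⟧ := PowerSeries.map PowerSeries.C

theorem coeff_inU_mul_inV (f g : A⟦X⟧) (r s : ℕ) :
    PowerSeries.coeff r (PowerSeries.coeff s (inU A f * inV A g)) =
      PowerSeries.coeff r f * PowerSeries.coeff s g := by
  simp [inU, inV]

theorem coeff_inV_mul_inU (f g : A⟦X⟧) (r s : ℕ) :
    PowerSeries.coeff r (PowerSeries.coeff s (inV A g * inU A f)) =
      PowerSeries.coeff s g * PowerSeries.coeff r f := by
  simp [inU, inV]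

theorem commute_xVar (b : A⟦X⟧⟦X⟧) : Commute (xVar A) b := by
  ext r : 1
  rw [xVar, PowerSeries.coeff_C_mul, PowerSeries.coeff_mul_C]
  exact (PowerSeries.commute_X _).symm

theorem commute_yVar (b : A⟦X⟧⟦X⟧) : Commute (yVar A) b := (PowerSeries.commute_X _).symm

theorem ext_coeff {f g : A⟦X⟧⟦X⟧}
    (h : ∀ r s, PowerSeries.coeff r (PowerSeries.coeff s f) =
      PowerSeries.coeff r (PowerSeries.coeff s g)) : f = g := by
  ext s r
  exact h r s

theorem coeff_xVar_mul_zero (f : A⟦X⟧⟦X⟧) (s : ℕ) :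
    PowerSeries.coeff 0 (PowerSeries.coeff s (xVar A * f)) = 0 := by
  simp [xVar]

theorem coeff_xVar_mul_succ (f : A⟦X⟧⟦X⟧) (r s : ℕ) :
    PowerSeries.coeff (r + 1) (PowerSeries.coeff s (xVar A * f)) =
      PowerSeries.coeff r (PowerSeries.coeff s f) := by
  simp [xVar, PowerSeries.coeff_succ_X_mul]

theorem coeff_yVar_mul_zero (f : A⟦X⟧⟦X⟧) (r : ℕ) :
    PowerSeries.coeff r (PowerSeries.coeff 0 (yVar A * f)) = 0 := by
  simp [yVar]

theorem coeff_yVar_mul_succ (f : A⟦X⟧⟦X⟧) (r s : ℕ) :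
    PowerSeries.coeff r (PowerSeries.coeff (s + 1) (yVar A * f)) =
      PowerSeries.coeff r (PowerSeries.coeff s f) := by
  simp [yVar, PowerSeries.coeff_succ_X_mul]

/-- Multiplication by `u⁻¹` is injective on each coefficient of a power of `v⁻¹`, so the
coefficients of `f` vanish successively in increasing powers of `v⁻¹`. -/
theorem eq_zero_of_yVar_sub_xVar_mul (f : A⟦X⟧⟦X⟧) (h : (yVar A - xVar A) * f = 0) : f = 0 := by
  have key : ∀ s r, PowerSeries.coeff r (PowerSeries.coeff s f) = 0 := by
    intro s
    induction s with
    | zero =>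
      intro r
      have := congrArg (fun z => PowerSeries.coeff (r + 1) (PowerSeries.coeff 0 z)) h
      simpa only [sub_mul, map_sub, coeff_xVar_mul_succ, coeff_yVar_mul_zero, zero_sub,
        neg_eq_zero, map_zero] using this
    | succ s ih =>
      intro r
      have := congrArg (fun z => PowerSeries.coeff (r + 1) (PowerSeries.coeff (s + 1) z)) h
      simpa only [sub_mul, map_sub, coeff_xVar_mul_succ, coeff_yVar_mul_succ, ih, zero_sub,
        neg_eq_zero, map_zero] using this
  exact ext_coeff fun r s => by rw [key]; simp

/-- With `x = u⁻¹` and `y = v⁻¹` one has `u - v = (y - x)/(x y)`. Clearing denominators gives `α = y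
- x` and `β = x y`. -/
theorem pair_seriesMatrix_iff {t : Fin n → Fin n → ℕ → A}
    (h0 : ∀ i j, t i j 0 = if i = j then 1 else 0) :
    IsRTTFamily t ↔ Pair (yVar A - xVar A) (xVar A * yVar A)
      ((seriesMatrix t).map (inU A)) ((seriesMatrix t).map (inV A)) := by
  have cc : ∀ i j h k r s, PowerSeries.coeff r (PowerSeries.coeff s
      ((seriesMatrix t).map (inU A) i j * (seriesMatrix t).map (inV A) h k -
        (seriesMatrix t).map (inV A) h k * (seriesMatrix t).map (inU A) i j)) =
      t i j r * t h k s - t h k s * t i j r := by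
    intro i j h k r s
    simp only [Matrix.map_apply, map_sub, coeff_inU_mul_inV, coeff_inV_mul_inU, seriesMatrix,
      Matrix.of_apply, PowerSeries.coeff_mk]
  have cd : ∀ i j h k r s, PowerSeries.coeff r (PowerSeries.coeff s
      ((seriesMatrix t).map (inU A) h j * (seriesMatrix t).map (inV A) i k -
        (seriesMatrix t).map (inV A) h j * (seriesMatrix t).map (inU A) i k)) =
      t h j r * t i k s - t h j s * t i k r := by
    intro i j h k r s
    simp only [Matrix.map_apply, map_sub, coeff_inU_mul_inV, coeff_inV_mul_inU, seriesMatrix,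
      Matrix.of_apply, PowerSeries.coeff_mk]
  constructor
  · intro ht i j h k
    apply ext_coeff
    rintro (_ | r) (_ | s)
    · rw [mul_assoc, coeff_xVar_mul_zero, sub_mul, map_sub, map_sub, coeff_xVar_mul_zero,
        coeff_yVar_mul_zero, sub_zero]
    · rw [mul_assoc, coeff_xVar_mul_zero, sub_mul, map_sub, map_sub, coeff_xVar_mul_zero,
        coeff_yVar_mul_succ, sub_zero, cc, ht.commutator_zero_left]
    · rw [mul_assoc, coeff_xVar_mul_succ, sub_mul, map_sub, map_sub, coeff_xVar_mul_succ,
        coeff_yVar_mul_zero, coeff_yVar_mul_zero, zero_sub, cc, ht.commutator_zero_right, neg_zero]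
    · rw [mul_assoc, coeff_xVar_mul_succ, sub_mul, map_sub, map_sub, coeff_xVar_mul_succ,
        coeff_yVar_mul_succ, coeff_yVar_mul_succ, cc, cc, cd, ht.rtt]
  · intro H
    refine ⟨h0, fun i j h k r s => ?_⟩
    have := congrArg (fun z => PowerSeries.coeff (r + 1) (PowerSeries.coeff (s + 1) z))
      (H i j h k)
    rwa [mul_assoc, coeff_xVar_mul_succ, sub_mul, map_sub, map_sub, coeff_xVar_mul_succ,
        coeff_yVar_mul_succ, coeff_yVar_mul_succ, cc, cc, cd] at this

end RTT

/-! ### The shift `u ↦ u - c` -/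

namespace Yangian

/-- The expansion of `(u - c)⁻¹` in `u⁻¹`. -/
noncomputable def shiftVar (c : ℂ) : ℂ⟦X⟧ :=
  (PowerSeries.X : ℂ⟦X⟧) * (1 - PowerSeries.C c * PowerSeries.X)⁻¹

theorem shiftVar_mul (c : ℂ) : shiftVar c * (1 - PowerSeries.C c * PowerSeries.X) = PowerSeries.X := by
  rw [shiftVar, mul_assoc, PowerSeries.inv_mul_cancel _ (by simp), mul_one]

/-- This is the identity `(u - c) - (u - c - 1) = 1`, divided by both factors. -/
theorem shiftVar_mul_shiftVar_add_one (c : ℂ) :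
    shiftVar c * shiftVar (c + 1) = shiftVar (c + 1) - shiftVar c := by
  have h : (PowerSeries.X : ℂ⟦X⟧) ≠ 0 := PowerSeries.X_ne_zero
  have e1 := shiftVar_mul c
  have e2 := shiftVar_mul (c + 1)
  apply mul_right_cancel₀ h
  rw [map_add, map_one] at e2
  linear_combination shiftVar (c + 1) * e1 - shiftVar c * e2

theorem coeff_shiftVar_pow_mul_pow_of_lt (c d : ℂ) {m r s : ℕ} (h : m < r + s) :
    PowerSeries.coeff m (shiftVar c ^ r * shiftVar d ^ s) = 0 := by
  rw [shiftVar, shiftVar, mul_pow, mul_pow, mul_mul_mul_comm, ← pow_add,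
    PowerSeries.coeff_X_pow_mul', if_neg (by omega)]

theorem coeff_shiftVar_pow_of_lt (c : ℂ) {m r : ℕ} (h : m < r) :
    PowerSeries.coeff m (shiftVar c ^ r) = 0 := by
  have := coeff_shiftVar_pow_mul_pow_of_lt c 0 (m := m) (r := r) (s := 0) (by omega)
  simpa using this

theorem coeff_shiftVar_pow_self (c : ℂ) (m : ℕ) :
    PowerSeries.coeff m (shiftVar c ^ m) = 1 := by
  rw [shiftVar, mul_pow, PowerSeries.coeff_X_pow_mul', if_pos le_rfl, Nat.sub_self,
    PowerSeries.coeff_zero_eq_constantCoeff_apply, map_pow, PowerSeries.constantCoeff_inv]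
  simp

variable {A : Type*} [Ring A] [Algebra ℂ A]

theorem coeff_shift (c : ℂ) (f : A⟦X⟧) (m : ℕ) : PowerSeries.coeff m (shift c f) =
    ∑ r ∈ Finset.range (m + 1),
      PowerSeries.coeff m (shiftVar c ^ r) • PowerSeries.coeff r f := by
  rw [shift, PowerSeries.coeff_mk]
  rfl

theorem coeff_shift_of_le (c : ℂ) (f : A⟦X⟧) {m N : ℕ} (h : m < N) :
    PowerSeries.coeff m (shift c f) =
      ∑ r ∈ Finset.range N, PowerSeries.coeff m (shiftVar c ^ r) • PowerSeries.coeff r f := by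
  rw [coeff_shift]
  refine Finset.sum_subset (Finset.range_mono h) fun r _ hr => ?_
  rw [coeff_shiftVar_pow_of_lt c (by simpa using hr), zero_smul]

theorem coeff_shift_mul_shift (c d : ℂ) (f g : A⟦X⟧) {m N : ℕ} (h : m < N) :
    PowerSeries.coeff m (shift c f * shift d g) =
      ∑ r ∈ Finset.range N, ∑ s ∈ Finset.range N,
        PowerSeries.coeff m (shiftVar c ^ r * shiftVar d ^ s) •
          (PowerSeries.coeff r f * PowerSeries.coeff s g) := by
  rw [PowerSeries.coeff_mul]
  simp only [PowerSeries.coeff_mul (R := ℂ), Finset.sum_smul]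
  have e : ∀ p ∈ Finset.HasAntidiagonal.antidiagonal m,
      PowerSeries.coeff p.1 (shift c f) * PowerSeries.coeff p.2 (shift d g) =
      ∑ r ∈ Finset.range N, ∑ s ∈ Finset.range N,
        (PowerSeries.coeff p.1 (shiftVar c ^ r) * PowerSeries.coeff p.2 (shiftVar d ^ s)) •
          (PowerSeries.coeff r f * PowerSeries.coeff s g) := by
    intro p hp
    have := Finset.HasAntidiagonal.mem_antidiagonal.1 hp
    rw [coeff_shift_of_le c f (show p.1 < N by omega),
      coeff_shift_of_le d g (show p.2 < N by omega), Finset.sum_mul_sum]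
    simp only [smul_mul_smul_comm]
  rw [Finset.sum_congr rfl e, Finset.sum_comm]
  refine Finset.sum_congr rfl fun r _ => ?_
  rw [Finset.sum_comm]

theorem shift_mul (c : ℂ) (f g : A⟦X⟧) : shift c (f * g) = shift c f * shift c g := by
  ext m
  rw [coeff_shift_mul_shift c c f g (Nat.lt_succ_self m), coeff_shift]
  simp only [PowerSeries.coeff_mul (R := A), Finset.smul_sum, ← pow_add]
  rw [Finset.sum_sigma', ← Finset.sum_product']
  refine Finset.sum_of_injOn (fun x => x.2) ?_ ?_ ?_ ?_
  · rintro ⟨a, p⟩ ha ⟨b, q⟩ hb hab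
    simp only [Finset.coe_sigma, Set.mem_sigma_iff, Finset.mem_coe,
      Finset.HasAntidiagonal.mem_antidiagonal] at ha hb hab
    subst hab
    rw [← ha.2, ← hb.2]
  · rintro ⟨a, p⟩ ha
    simp only [Finset.coe_sigma, Set.mem_sigma_iff, Finset.mem_coe, Finset.mem_range,
      Finset.HasAntidiagonal.mem_antidiagonal, Finset.mem_product] at ha ⊢
    omega
  · rintro ⟨r, s⟩ hrs hn
    -- The index pairs outside the triangle `r + s ≤ m` contribute nothing, since `shiftVar c ^ (r +
    -- s)` has order `r + s`.
    have : ¬ r + s < m + 1 := by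
      intro h
      apply hn
      refine ⟨⟨r + s, (r, s)⟩, ?_, rfl⟩
      simpa using h
    rw [coeff_shiftVar_pow_of_lt c (by omega), zero_smul]
  · rintro ⟨a, p⟩ ha
    simp only [Finset.mem_sigma, Finset.HasAntidiagonal.mem_antidiagonal] at ha
    rw [ha.2]

theorem shift_one (c : ℂ) : shift c (1 : A⟦X⟧) = 1 := by
  ext m
  rw [coeff_shift, Finset.sum_range_succ']
  simp only [PowerSeries.coeff_one, Nat.add_eq_zero_iff, one_ne_zero, and_false, if_false,
    smul_zero, Finset.sum_const_zero, zero_add, pow_zero, if_true]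
  split_ifs <;> simp

/-- The shift as a ring homomorphism. -/
noncomputable def shiftHom (A : Type*) [Ring A] [Algebra ℂ A] (c : ℂ) : A⟦X⟧ →+* A⟦X⟧ where
  toFun := shift c
  map_one' := shift_one c
  map_mul' := shift_mul c
  map_zero' := by ext m; simp [coeff_shift]
  map_add' f g := by ext m; simp [coeff_shift, Finset.sum_add_distrib]

theorem shiftHom_apply (c : ℂ) (f : A⟦X⟧) : shiftHom A c f = shift c f := rfl

theorem shift_C (c : ℂ) (a : A) : shift c (PowerSeries.C a) = PowerSeries.C a := by
  ext m
  rw [coeff_shift, Finset.sum_range_succ']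
  simp only [PowerSeries.coeff_C, Nat.add_eq_zero_iff, one_ne_zero, and_false, if_false,
    smul_zero, Finset.sum_const_zero, zero_add, pow_zero, if_true, PowerSeries.coeff_one]
  split_ifs <;> simp

/-- Summation by parts for the pair of variables `(u - c)⁻¹`, `(u - c - 1)⁻¹`. -/
theorem sum_shiftVar_by_parts (a : ℂ) (m : ℕ) (c : ℕ → ℕ → A) (h1 : ∀ s, c 0 s = 0)
    (h2 : ∀ r, c r 0 = 0) :
    ∑ r ∈ Finset.range (m + 2), ∑ s ∈ Finset.range (m + 2),
        PowerSeries.coeff m (shiftVar a ^ r * shiftVar (a + 1) ^ s) • c r s =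
      ∑ r ∈ Finset.range (m + 2), ∑ s ∈ Finset.range (m + 2),
        PowerSeries.coeff m (shiftVar a ^ r * shiftVar (a + 1) ^ s) •
          (c (r + 1) s - c r (s + 1)) := by
  set κ : ℕ → ℕ → ℂ := fun r s =>
    PowerSeries.coeff m (shiftVar a ^ r * shiftVar (a + 1) ^ s) with hκ
  -- The weights satisfy this recursion because the two variables differ by their product; the
  -- boundary terms vanish by `h1`, `h2` and the order of vanishing of the weights.
  have hrec : ∀ r s, κ (r + 1) (s + 1) = κ r (s + 1) - κ (r + 1) s := by
    intro r s
    simp only [hκ]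
    rw [← map_sub]
    congr 1
    have := shiftVar_mul_shiftVar_add_one a
    linear_combination (shiftVar a ^ r * shiftVar (a + 1) ^ s) * this
  have hz : ∀ r s, m < r + s → κ r s = 0 := fun r s h =>
    coeff_shiftVar_pow_mul_pow_of_lt a (a + 1) h
  have e0 : ∑ r ∈ Finset.range (m + 2), ∑ s ∈ Finset.range (m + 2), κ r s • c r s =
      ∑ r ∈ Finset.range (m + 1), ∑ s ∈ Finset.range (m + 1),
        κ (r + 1) (s + 1) • c (r + 1) (s + 1) := by
    rw [Finset.sum_range_succ']
    simp only [h1, smul_zero, Finset.sum_const_zero, add_zero]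
    refine Finset.sum_congr rfl fun r _ => ?_
    rw [Finset.sum_range_succ', h2, smul_zero, add_zero]
  have e1 : ∑ r ∈ Finset.range (m + 2), ∑ s ∈ Finset.range (m + 2), κ r s • c (r + 1) s =
      ∑ r ∈ Finset.range (m + 1), ∑ s ∈ Finset.range (m + 1),
        κ r (s + 1) • c (r + 1) (s + 1) := by
    rw [Finset.sum_range_succ]
    rw [Finset.sum_eq_zero (s := Finset.range (m + 2))
      (f := fun s => κ (m + 1) s • c (m + 1 + 1) s)
      (fun s _ => by rw [hz _ _ (by omega), zero_smul]), add_zero]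
    refine Finset.sum_congr rfl fun r _ => ?_
    rw [Finset.sum_range_succ', h2, smul_zero, add_zero]
  have e2 : ∑ r ∈ Finset.range (m + 2), ∑ s ∈ Finset.range (m + 2), κ r s • c r (s + 1) =
      ∑ r ∈ Finset.range (m + 1), ∑ s ∈ Finset.range (m + 1),
        κ (r + 1) s • c (r + 1) (s + 1) := by
    rw [Finset.sum_range_succ']
    simp only [h1, smul_zero, Finset.sum_const_zero, add_zero]
    refine Finset.sum_congr rfl fun r _ => ?_
    rw [Finset.sum_range_succ, hz _ _ (by omega), zero_smul, add_zero]
  simp only [smul_sub, Finset.sum_sub_distrib]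
  rw [e0, e1, e2]
  simp only [hrec, sub_smul, Finset.sum_sub_distrib]

/-- Specialising the two variables to `u - c` and `u - c - 1` makes their difference `1`, so no
denominators remain and `R` becomes `1 - Π`. This is the relation behind quantum minors. -/
theorem _root_.IsRTTFamily.pair_shift {n : ℕ} {t : Fin n → Fin n → ℕ → A} (ht : IsRTTFamily t)
    (c : ℂ) : RTT.Pair 1 1 ((RTT.seriesMatrix t).map (shiftHom A c))
      ((RTT.seriesMatrix t).map (shiftHom A (c + 1))) := by
  intro i j h k
  simp only [Matrix.map_apply, shiftHom_apply, RTT.seriesMatrix, Matrix.of_apply, one_mul]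
  ext m
  have lt : m < m + 2 := by omega
  have key := sum_shiftVar_by_parts c m (fun r s => t i j r * t h k s - t h k s * t i j r)
    (fun s => ht.commutator_zero_left i j h k s) (fun r => ht.commutator_zero_right i j h k r)
  simp only [ht.rtt] at key
  simp only [map_sub]
  rw [coeff_shift_mul_shift _ _ _ _ lt, coeff_shift_mul_shift _ _ _ _ lt,
    coeff_shift_mul_shift _ _ _ _ lt, coeff_shift_mul_shift _ _ _ _ lt]
  simp only [PowerSeries.coeff_mk]
  rw [Finset.sum_comm (f := fun r s => PowerSeries.coeff m
      (shiftVar (c + 1) ^ r * shiftVar c ^ s) • (t h k r * t i j s)),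
    Finset.sum_comm (f := fun r s => PowerSeries.coeff m
      (shiftVar (c + 1) ^ r * shiftVar c ^ s) • (t h j r * t i k s))]
  simp only [mul_comm (shiftVar (c + 1) ^ _)]
  simp only [← Finset.sum_sub_distrib, ← smul_sub]
  exact key

end Yangian

/-! ### Gaussian elimination and inverse matrices -/

section Inverse

variable {R : Type*} [Ring R] {n : ℕ}

/-- A power series of matrices as a matrix of power series. -/
noncomputable def matrixOfSeries (N : (Matrix (Fin n) (Fin n) R)⟦X⟧) :
    Matrix (Fin n) (Fin n) R⟦X⟧ :=
  Matrix.of fun i j => PowerSeries.mk fun r => PowerSeries.coeff r N i j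

theorem matrixOfSeries_mul (N N' : (Matrix (Fin n) (Fin n) R)⟦X⟧) :
    matrixOfSeries (N * N') = matrixOfSeries N * matrixOfSeries N' := by
  ext i j r
  simp only [matrixOfSeries, Matrix.of_apply, PowerSeries.coeff_mk, PowerSeries.coeff_mul,
    Matrix.mul_apply, Matrix.sum_apply, map_sum]
  rw [Finset.sum_comm]

theorem matrixOfSeries_one :
    matrixOfSeries (1 : (Matrix (Fin n) (Fin n) R)⟦X⟧) = 1 := by
  ext i j r
  by_cases hij : i = j <;> by_cases hr : r = 0 <;>
  simp [matrixOfSeries, PowerSeries.coeff_one, Matrix.one_apply, hij, hr]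

/-- Viewed as a power series with matrix coefficients, `M` has constant term `1`, so it is
invertible even though `R` is noncommutative. -/
theorem exists_inverse {M : Matrix (Fin n) (Fin n) R⟦X⟧}
    (hM : ∀ i j, PowerSeries.constantCoeff (M i j) = (1 : Matrix (Fin n) (Fin n) R) i j) :
    ∃ S, M * S = 1 ∧ S * M = 1 := by
  set N : (Matrix (Fin n) (Fin n) R)⟦X⟧ :=
    PowerSeries.mk fun r => Matrix.of fun i j => PowerSeries.coeff r (M i j) with hN
  have hMN : M = matrixOfSeries N := by
    ext i j r
    simp [matrixOfSeries, hN]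
  have hN1 : PowerSeries.constantCoeff N = ((1 : (Matrix (Fin n) (Fin n) R)ˣ) :
      Matrix (Fin n) (Fin n) R) := by
    ext i j
    rw [hN, ← PowerSeries.coeff_zero_eq_constantCoeff_apply, PowerSeries.coeff_mk, Matrix.of_apply,
      PowerSeries.coeff_zero_eq_constantCoeff_apply, hM, Units.val_one]
  refine ⟨matrixOfSeries (PowerSeries.invOfUnit N 1), ?_, ?_⟩
  · rw [hMN, ← matrixOfSeries_mul, PowerSeries.mul_invOfUnit _ _ hN1, matrixOfSeries_one]
  · rw [hMN, ← matrixOfSeries_mul, PowerSeries.invOfUnit_mul _ _ hN1, matrixOfSeries_one]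

theorem Commute.of_inverse {S : Type*} [Monoid S] {c a b : S} (h : Commute c a)
    (hab : a * b = 1) (hba : b * a = 1) : Commute c b :=
  Commute.units_inv_right (u := (⟨a, b, hab, hba⟩ : Sˣ)) h

end Inverse

/-! ### Blocks left by elimination as inverses of blocks of the inverse matrix. -/

section Elim

variable {R : Type*} [Ring R] {n : ℕ} {M S : Matrix (Fin n) (Fin n) R⟦X⟧}

/-- Each step subtracts a left multiple of the pivot row. Against a column `l` of `S` beyond the
pivot, that row contributes an off-diagonal entry of the identity, namely zero. -/
theorem gaussElim_mul_inverse (hMS : M * S = 1) (k : ℕ) (hk : k ≤ n) (i l : Fin n)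
    (hi : k ≤ i) (hl : k ≤ l) : ∑ j, gaussElim M k i j * S j l = (1 : Matrix _ _ R⟦X⟧) i l := by
  induction k generalizing i with
  | zero => rw [← hMS, Matrix.mul_apply]; rfl
  | succ k ih =>
    set p : Fin n := ⟨k, hk⟩
    have hs : ∀ j, gaussElim M (k + 1) i j = gaussElim M k i j
      - gaussElim M k i p * PowerSeries.invOfUnit (gaussElim M k p p) 1 * gaussElim M k p j :=
      fun j => gaussElim_succ p i j
    have hpl : p ≠ l := fun h => by rw [← h] at hl; exact absurd hl (Nat.not_succ_le_self k)
    simp only [hs, sub_mul, Finset.sum_sub_distrib, mul_assoc, ← Finset.mul_sum]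
    rw [ih (by omega) i (by omega) (by omega), ih (by omega) p le_rfl (by omega),
      Matrix.one_apply_ne hpl, mul_zero, mul_zero, sub_zero]

theorem inverse_mul_gaussElim (hSM : S * M = 1) (k : ℕ) (hk : k ≤ n) (i l : Fin n)
    (hi : k ≤ i) (hl : k ≤ l) : ∑ j, S i j * gaussElim M k j l = (1 : Matrix _ _ R⟦X⟧) i l := by
  induction k generalizing l with
  | zero => rw [← hSM, Matrix.mul_apply]; rfl
  | succ k ih =>
    set p : Fin n := ⟨k, hk⟩
    have hs : ∀ j, gaussElim M (k + 1) j l = gaussElim M k j l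
      - gaussElim M k j p * PowerSeries.invOfUnit (gaussElim M k p p) 1 * gaussElim M k p l :=
      fun j => gaussElim_succ p j l
    have hpl : i ≠ p := fun h => by rw [h] at hi; exact absurd hi (Nat.not_succ_le_self k)
    simp only [hs, mul_sub, Finset.sum_sub_distrib, ← mul_assoc, ← Finset.sum_mul]
    rw [ih (by omega) l (by omega) (by omega), ih (by omega) p (by omega) le_rfl,
      Matrix.one_apply_ne hpl, zero_mul, zero_mul, sub_zero]

/-- The block of `M` with indices `≥ k`. -/
def lowerBlock {S : Type*} (M : Matrix (Fin n) (Fin n) S) (k : ℕ) :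
    Matrix {i : Fin n // k ≤ (i : ℕ)} {i : Fin n // k ≤ (i : ℕ)} S :=
  M.submatrix Subtype.val Subtype.val

/-- The columns already eliminated vanish, so the full sum over `j` reduces to the block. Thus the
remaining block (the Schur complement) is inverse to the corresponding block of `M⁻¹`, where
commutation relations are easier to see. -/
theorem lowerBlock_mul_lowerBlock
    (hM : ∀ i j, PowerSeries.constantCoeff (M i j) = (1 : Matrix (Fin n) (Fin n) R) i j) (hMS : M * S = 1) (k : ℕ) (hk : k ≤ n) :
    lowerBlock (gaussElim M k) k * lowerBlock S k = 1 := by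
  ext1 i l
  have h := gaussElim_mul_inverse hMS k hk i l i.2 l.2
  have h1 : (1 : Matrix (Fin n) (Fin n) R⟦X⟧) i l =
      (1 : Matrix {i : Fin n // k ≤ (i : ℕ)} {i : Fin n // k ≤ (i : ℕ)} R⟦X⟧) i l := by
    by_cases hil : i = l
    · rw [hil, Matrix.one_apply_eq, Matrix.one_apply_eq]
    · rw [Matrix.one_apply_ne hil, Matrix.one_apply_ne (fun e => hil (Subtype.ext e))]
  rw [← h1, ← h, Matrix.mul_apply]
  simp only [lowerBlock, Matrix.submatrix_apply]
  refine Finset.sum_of_injOn Subtype.val Subtype.val_injective.injOn (by simp) ?_ (fun _ _ => rfl)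
  intro j _ hj
  rw [(gaussElim_invariant hM k hk).2 i j (Or.inr ?_), zero_mul]
  by_contra hc
  exact hj ⟨⟨j, not_lt.1 hc⟩, by simp, rfl⟩

theorem lowerBlock_mul_lowerBlock'
    (hM : ∀ i j, PowerSeries.constantCoeff (M i j) = (1 : Matrix (Fin n) (Fin n) R) i j) (hSM : S * M = 1) (k : ℕ) (hk : k ≤ n) :
    lowerBlock S k * lowerBlock (gaussElim M k) k = 1 := by
  ext1 i l
  have h := inverse_mul_gaussElim hSM k hk i l i.2 l.2
  have h1 : (1 : Matrix (Fin n) (Fin n) R⟦X⟧) i l =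
      (1 : Matrix {i : Fin n // k ≤ (i : ℕ)} {i : Fin n // k ≤ (i : ℕ)} R⟦X⟧) i l := by
    by_cases hil : i = l
    · rw [hil, Matrix.one_apply_eq, Matrix.one_apply_eq]
    · rw [Matrix.one_apply_ne hil, Matrix.one_apply_ne (fun e => hil (Subtype.ext e))]
  rw [← h1, ← h, Matrix.mul_apply]
  simp only [lowerBlock, Matrix.submatrix_apply]
  refine Finset.sum_of_injOn Subtype.val Subtype.val_injective.injOn (by simp) ?_ (fun _ _ => rfl)
  intro j _ hj
  rw [(gaussElim_invariant hM k hk).2 j l (Or.inl ?_), mul_zero]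
  by_contra hc
  exact hj ⟨⟨j, not_lt.1 hc⟩, by simp, rfl⟩

/-- Later elimination steps use only products and inverses of entries whose indices lie in `s`,
provided that `s` contains the pivots. -/
theorem commute_gaussElim_of_pivots
    (hM : ∀ i j, PowerSeries.constantCoeff (M i j) = (1 : Matrix (Fin n) (Fin n) R) i j) {c : R⟦X⟧} {s : Set (Fin n)} {m : ℕ}
    (h : ∀ i ∈ s, ∀ j ∈ s, Commute c (gaussElim M m i j)) {k : ℕ} (hmk : m ≤ k) (hk : k ≤ n)
    (hs : ∀ p : Fin n, m ≤ (p : ℕ) → (p : ℕ) < k → p ∈ s) :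
    ∀ i ∈ s, ∀ j ∈ s, Commute c (gaussElim M k i j) := by
  induction k, hmk using Nat.le_induction with
  | base => exact h
  | succ k hmk ih =>
    intro i hi j hj
    have ih' := ih (by omega) (fun p h1 h2 => hs p h1 (by omega))
    set p : Fin n := ⟨k, hk⟩ with hp
    have hps : p ∈ s := hs p hmk (Nat.lt_succ_self k)
    have e : gaussElim M (k + 1) i j = gaussElim M k i j
      - gaussElim M k i p * PowerSeries.invOfUnit (gaussElim M k p p) 1 * gaussElim M k p j :=
      gaussElim_succ p i j
    have hpp : PowerSeries.constantCoeff (gaussElim M k p p) = ((1 : Rˣ) : R) :=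
      gaussDiag_constantCoeff hM p
    rw [e]
    refine (ih' i hi j hj).sub_right (((ih' i hi p hps).mul_right ?_).mul_right (ih' p hps j hj))
    exact (ih' p hps p hps).of_inverse (PowerSeries.mul_invOfUnit _ _ hpp)
      (PowerSeries.invOfUnit_mul _ _ hpp)

end Elim

/-! ### Gaussian elimination under ring homomorphisms. -/

section Map

variable {R R' : Type*} [Ring R] [Ring R'] {n : ℕ}

theorem map_invOfUnit_one (f : R →+* R') {a : R⟦X⟧}
    (ha : PowerSeries.constantCoeff a = ((1 : Rˣ) : R)) :
    PowerSeries.map f (PowerSeries.invOfUnit a 1) =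
      PowerSeries.invOfUnit (PowerSeries.map f a) 1 := by
  have h1 : PowerSeries.constantCoeff (PowerSeries.map f a) = ((1 : R'ˣ) : R') := by
    rw [← PowerSeries.coeff_zero_eq_constantCoeff_apply, PowerSeries.coeff_map,
      PowerSeries.coeff_zero_eq_constantCoeff_apply, ha, Units.val_one, map_one, Units.val_one]
  refine left_inv_eq_right_inv (a := PowerSeries.map f a) ?_ (PowerSeries.mul_invOfUnit _ _ h1)
  rw [← map_mul, PowerSeries.invOfUnit_mul _ _ ha, map_one]

theorem map_gaussElim (f : R →+* R') {M : Matrix (Fin n) (Fin n) R⟦X⟧}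
    (hM : ∀ i j, PowerSeries.constantCoeff (M i j) = (1 : Matrix (Fin n) (Fin n) R) i j)
    (k : ℕ) (hk : k ≤ n) (i j : Fin n) :
    PowerSeries.map f (gaussElim M k i j) = gaussElim (M.map (PowerSeries.map f)) k i j := by
  induction k generalizing i j with
  | zero => rfl
  | succ k ih =>
    set p : Fin n := ⟨k, hk⟩
    have e := gaussElim_succ (M := M) p i j
    have e' := gaussElim_succ (M := M.map (PowerSeries.map f)) p i j
    have hpp : PowerSeries.constantCoeff (gaussElim M k p p) = ((1 : Rˣ) : R) :=
      gaussDiag_constantCoeff hM p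
    change gaussElim M (k + 1) i j = _ at e
    change gaussElim _ (k + 1) i j = _ at e'
    rw [e, e', map_sub, map_mul, map_mul]
    change _ - _ * PowerSeries.map f (PowerSeries.invOfUnit (gaussElim M k p p) 1) * _ = _
    rw [map_invOfUnit_one f hpp]
    simp only [p]
    rw [ih (by omega), ih (by omega), ih (by omega), ih (by omega)]

end Map

/-! ### Centrality of the coefficients of `C_n(u)` -/

section ZeroMode

variable {B ι : Type*} [Ring B] [DecidableEq ι]

/-- The element `c` acts on the entries of `N` by commutators as the matrix unit `e_{a,b}` does. -/
def ZeroMode (c : B) (a b : ι) (N : Matrix ι ι B) : Prop :=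
  ∀ h k, c * N h k - N h k * c = (if h = b then N a k else 0) - (if a = k then N h b else 0)

theorem ZeroMode.submatrix {κ : Type*} [DecidableEq κ] {c : B} {a b : κ} {f : κ → ι}
    (hf : Function.Injective f) {N : Matrix ι ι B} (H : ZeroMode c (f a) (f b) N) :
    ZeroMode c a b (N.submatrix f f) := by
  intro h k
  simpa [hf.eq_iff] using H (f h) (f k)

theorem ZeroMode.map {B' : Type*} [Ring B'] (f : B →+* B') {c : B} {a b : ι} {N : Matrix ι ι B}
    (H : ZeroMode c a b N) : ZeroMode (f c) a b (N.map f) := by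
  intro h k
  simpa [apply_ite f] using congrArg f (H h k)

/-- The zero modes attached to two indices `p, q` annihilate the corresponding `2 × 2` quantum
minor. -/
theorem ZeroMode.commute_minor {P Q : Matrix ι ι B} (H : RTT.Pair 1 1 P Q) {p q : ι}
    (hpq : p ≠ q) {c : B} (hc : ZeroMode c p q P ∧ ZeroMode c p q Q ∨
      ZeroMode c q p P ∧ ZeroMode c q p Q) :
    Commute c (P p p * Q q q - P q p * Q p q) := by
  have h1 := H p q q q
  have h2 := H p p q p
  simp only [one_mul] at h1 h2
  -- These two identities say that a quantum minor with a repeated column vanishes.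
  have h1' : P p q * Q q q = P q q * Q p q := by
    rw [← sub_eq_zero] at h1 ⊢
    rw [← h1]; abel
  have h2' : P p p * Q q p = P q p * Q p p := by
    rw [← sub_eq_zero] at h2 ⊢
    rw [← h2]; abel
  have hmul : ∀ x y, c * (x * y) - (x * y) * c = (c * x - x * c) * y + x * (c * y - y * c) := by
    intro x y
    simp only [sub_mul, mul_sub, mul_assoc]
    abel
  rw [commute_iff_eq, ← sub_eq_zero]
  have e : c * (P p p * Q q q - P q p * Q p q) - (P p p * Q q q - P q p * Q p q) * c =
      (c * (P p p * Q q q) - (P p p * Q q q) * c) - (c * (P q p * Q p q) - (P q p * Q p q) * c) := by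
    rw [mul_sub, sub_mul]; abel
  rw [e, hmul, hmul]
  rcases hc with ⟨a, b⟩ | ⟨a, b⟩
  · rw [a, a, b, b]
    simp only [hpq, if_true, if_false, sub_zero, zero_sub, neg_mul, sub_mul,
      sub_self, mul_zero, add_zero]
    rw [h1']
    abel
  · rw [a, a, b, b]
    simp only [hpq.symm, if_true, if_false, sub_zero, zero_sub, mul_neg, mul_sub,
      sub_self, zero_mul, zero_add]
    rw [h2']
    abel

variable [Fintype ι]

/-- Written as a commutation relation with a single matrix, the zero mode action passes to inverse
matrices. -/
theorem zeroMode_iff {c : B} {a b : ι} {N : Matrix ι ι B} :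
    ZeroMode c a b N ↔ Commute (Matrix.diagonal (fun _ => c) - Matrix.single b a 1) N := by
  have e1 : ∀ h k, ((Matrix.diagonal (fun _ => c) - Matrix.single b a 1 : Matrix ι ι B) * N) h k =
      c * N h k - if h = b then N a k else 0 := by
    intro h k
    rw [sub_mul, Matrix.sub_apply, Matrix.diagonal_mul]
    congr 1
    split_ifs with hb
    · subst hb; simp
    · exact Matrix.single_mul_apply_of_ne _ _ _ _ _ hb _
  have e2 : ∀ h k, (N * (Matrix.diagonal (fun _ => c) - Matrix.single b a 1 : Matrix ι ι B)) h k =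
      N h k * c - if a = k then N h b else 0 := by
    intro h k
    rw [mul_sub, Matrix.sub_apply, Matrix.mul_diagonal]
    congr 1
    split_ifs with hb
    · subst hb; simp
    · exact Matrix.mul_single_apply_of_ne _ _ _ _ _ (Ne.symm hb) _
  constructor
  · intro H
    ext h k
    rw [e1, e2]
    exact sub_eq_sub_iff_sub_eq_sub.1 (H h k)
  · intro H h k
    have := congrFun (congrFun H.eq h) k
    rw [e1, e2] at this
    exact sub_eq_sub_iff_sub_eq_sub.1 this

theorem ZeroMode.inv {c : B} {a b : ι} {N N' : Matrix ι ι B} (H : ZeroMode c a b N)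
    (h1 : N * N' = 1) (h2 : N' * N = 1) : ZeroMode c a b N' :=
  zeroMode_iff.2 ((zeroMode_iff.1 H).of_inverse h1 h2)

theorem commute_entries_iff {c : B} {N : Matrix ι ι B} :
    (∀ i j, Commute c (N i j)) ↔ Commute (Matrix.diagonal fun _ => c) N := by
  constructor
  · intro H
    ext i j
    rw [Matrix.diagonal_mul, Matrix.mul_diagonal]
    exact H i j
  · intro H i j
    have := congrFun (congrFun H.eq i) j
    rwa [Matrix.diagonal_mul, Matrix.mul_diagonal] at this

theorem commute_entries_of_inverse {c : B} {N N' : Matrix ι ι B} (H : ∀ i j, Commute c (N i j))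
    (h1 : N * N' = 1) (h2 : N' * N = 1) (i j : ι) : Commute c (N' i j) :=
  commute_entries_iff.2 ((commute_entries_iff.1 H).of_inverse h1 h2) i j

end ZeroMode

section Elim

variable {R : Type*} [Ring R] {n : ℕ} {M : Matrix (Fin n) (Fin n) R⟦X⟧}
theorem ZeroMode.lowerBlock_gaussElim
    (hM : ∀ i j, PowerSeries.constantCoeff (M i j) = (1 : Matrix (Fin n) (Fin n) R) i j) {c : R⟦X⟧} {k : ℕ} (hk : k ≤ n)
    {a b : {i : Fin n // k ≤ (i : ℕ)}} (H : ZeroMode c (a : Fin n) b M) :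
    ZeroMode c a b (lowerBlock (gaussElim M k) k) := by
  obtain ⟨S, h1, h2⟩ := exists_inverse hM
  exact ((H.inv h1 h2).submatrix Subtype.val_injective).inv (lowerBlock_mul_lowerBlock' hM h2 k hk)
    (lowerBlock_mul_lowerBlock hM h1 k hk)

theorem ZeroMode.commute_gaussElim
    (hM : ∀ i j, PowerSeries.constantCoeff (M i j) = (1 : Matrix (Fin n) (Fin n) R) i j) {c : R⟦X⟧} {k : ℕ} (hk : k ≤ n) {a b : Fin n} (ha : (a : ℕ) < k)
    (hb : (b : ℕ) < k) (H : ZeroMode c a b M) (i j : Fin n) : Commute c (gaussElim M k i j) := by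
  by_cases hij : (i : ℕ) < k ∨ (j : ℕ) < k
  · rw [(gaussElim_invariant hM k hk).2 i j hij]
    exact Commute.zero_right c
  push Not at hij
  obtain ⟨S, h1, h2⟩ := exists_inverse hM
  refine commute_entries_of_inverse (N := lowerBlock S k) ?_ (lowerBlock_mul_lowerBlock' hM h2 k hk)
    (lowerBlock_mul_lowerBlock hM h1 k hk) ⟨i, hij.1⟩ ⟨j, hij.2⟩
  -- The zero mode moves only row `b` and column `a`, both of which lie outside the block.
  intro i j
  have := H.inv h1 h2 i j
  rw [if_neg (fun e => by have := i.2; rw [e] at this; omega),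
    if_neg (fun e => by have := j.2; rw [← e] at this; omega), sub_zero, sub_eq_zero] at this
  exact this

end Elim

/-- The two adjacent factors need only commute with `c` jointly; this is what holds for the Gauss
factors `D_k`, `D_{k+1}` and the zero modes between them. -/
theorem commute_ofFn_prod {S : Type*} [Monoid S] {n : ℕ} {c : S} (g : Fin n → S) (k : ℕ)
    (hk : k + 1 < n) (h1 : ∀ i : Fin n, (i : ℕ) ≠ k → (i : ℕ) ≠ k + 1 → Commute c (g i))
    (h2 : Commute c (g ⟨k, by omega⟩ * g ⟨k + 1, hk⟩)) : Commute c (List.ofFn g).prod := by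
  induction k generalizing n with
  | zero =>
    obtain ⟨n, rfl⟩ : ∃ m, n = m + 2 := ⟨n - 2, by omega⟩
    rw [List.ofFn_succ, List.ofFn_succ, List.prod_cons, List.prod_cons, ← mul_assoc]
    refine Commute.mul_right h2 (Commute.list_prod_right _ _ ?_)
    intro x hx
    obtain ⟨i, rfl⟩ := (List.mem_ofFn' _ _).1 hx
    exact h1 _ (by simp) (by simp)
  | succ k ih =>
    obtain ⟨n, rfl⟩ : ∃ m, n = m + 1 := ⟨n - 1, by omega⟩
    rw [List.ofFn_succ, List.prod_cons]
    refine Commute.mul_right (h1 0 (by simp) (by simp)) (ih _ (by omega) ?_ h2)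
    intro i hi hi'
    exact h1 _ (by simpa using hi) (by simpa using hi')

/-! ### Commutation of generators with the Gauss factors. -/

namespace IsRTTFamily

variable {A : Type*} [Ring A] {n : ℕ} {t : Fin n → Fin n → ℕ → A}

theorem constantCoeff_seriesMatrix (ht : IsRTTFamily t) (i j : Fin n) :
    PowerSeries.constantCoeff (RTT.seriesMatrix t i j) = (1 : Matrix (Fin n) (Fin n) A) i j := by
  rw [RTT.seriesMatrix, Matrix.of_apply, ← PowerSeries.coeff_zero_eq_constantCoeff_apply,
    PowerSeries.coeff_mk, ht.zero, Matrix.one_apply]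

theorem zeroMode (ht : IsRTTFamily t) (a b : Fin n) :
    ZeroMode (PowerSeries.C (t a b 1)) a b (RTT.seriesMatrix t) := by
  intro h k
  ext s
  have := ht.commutator_one a b h k s
  simp only [RTT.seriesMatrix, Matrix.of_apply, map_sub, PowerSeries.coeff_C_mul,
    PowerSeries.coeff_mul_C, PowerSeries.coeff_mk]
  rw [this]
  split_ifs <;> simp

/-- If `c` is a zero mode with indices below `k`, it commutes with the diagonal Gauss factors
from the `k`-th on. -/
theorem commute_gaussDiag_of_lt (ht : IsRTTFamily t) {a b : Fin n} {i : Fin n} (ha : a < i) (hb : b < i) :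
    Commute (PowerSeries.C (t a b 1)) (gaussDiag (RTT.seriesMatrix t) i) :=
  (ht.zeroMode a b).commute_gaussElim ht.constantCoeff_seriesMatrix i.2.le ha hb i i

/-- The `i`-th Gauss factor involves only entries with indices at most `i`, which the zero mode does
not move. -/
theorem commute_gaussDiag_of_gt (ht : IsRTTFamily t) {a b : Fin n} {i : Fin n} (ha : i < a) (hb : i < b) :
    Commute (PowerSeries.C (t a b 1)) (gaussDiag (RTT.seriesMatrix t) i) := by
  refine commute_gaussElim_of_pivots ht.constantCoeff_seriesMatrix (s := {j | j ≤ i}) (m := 0)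
    ?_ (Nat.zero_le _) i.2.le (fun p _ h => le_of_lt (Fin.lt_def.2 h)) i (le_refl i) i (le_refl i)
  intro h hh k hk
  have := ht.zeroMode a b h k
  rw [if_neg (by rintro rfl; exact absurd (lt_of_lt_of_le hb hh) (lt_irrefl _)),
    if_neg (by rintro rfl; exact absurd (lt_of_lt_of_le ha hk) (lt_irrefl _)), sub_zero,
    sub_eq_zero] at this
  exact this

/-- The coefficients of `t_{0,0}(u)` commute with the diagonal Gauss factors. -/
theorem commute_gaussDiag_zero (ht : IsRTTFamily t) (hn : 0 < n) (r : ℕ) (i : Fin n) :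
    Commute (PowerSeries.C (t ⟨0, hn⟩ ⟨0, hn⟩ r)) (gaussDiag (RTT.seriesMatrix t) i) := by
  set z : Fin n := ⟨0, hn⟩ with hz
  set M := RTT.seriesMatrix t with hMdef
  have hM := ht.constantCoeff_seriesMatrix
  rcases Nat.eq_zero_or_pos (i : ℕ) with h0 | hpos
  · have : i = z := Fin.ext h0
    subst this
    have e : gaussDiag M z = PowerSeries.mk (t z z) := rfl
    rw [e]
    ext s
    rw [PowerSeries.coeff_C_mul, PowerSeries.coeff_mul_C, PowerSeries.coeff_mk]
    exact ht.commute_diag z r s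
  obtain ⟨S, h1, h2⟩ := exists_inverse hM
  have H := (RTT.pair_seriesMatrix_iff ht.zero).1 ht
  have hx := RTT.commute_xVar (A := A)
  have hy := RTT.commute_yVar (A := A)
  have map1 : ∀ (f : A⟦X⟧ →+* A⟦X⟧⟦X⟧) {κ : Type} [Fintype κ] [DecidableEq κ]
      {U V : Matrix κ κ A⟦X⟧}, U * V = 1 → U.map f * V.map f = 1 := by
    intro f κ _ _ U V hUV
    rw [← Matrix.map_mul, hUV, Matrix.map_one _ (map_zero f) (map_one f)]
  -- By `Pair.commute_inv`, the corner series in `u` commutes with all entries of the inverse matrix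
  -- in `v` outside the first row and column.
  have hblock : ∀ i j : {i : Fin n // 1 ≤ (i : ℕ)},
      Commute (RTT.inU A (M z z)) ((lowerBlock S 1).map (RTT.inV A) i j) := by
    intro i j
    refine H.commute_inv (fun b => (hy b).sub_left (hx b)) RTT.eq_zero_of_yVar_sub_xVar_mul
      (fun b => (hx b).mul_left (hy b)) (map1 _ h1) (map1 _ h2) ?_ ?_
    · intro e; have := j.2; rw [← e] at this; simp [hz] at this
    · intro e; have := i.2; rw [← e] at this; simp [hz] at this
  have hinv := commute_entries_of_inverse hblock
    (map1 (RTT.inV A) (lowerBlock_mul_lowerBlock' hM h2 1 hn))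
    (map1 (RTT.inV A) (lowerBlock_mul_lowerBlock hM h1 1 hn))
  have hone : ∀ i j : Fin n, Commute (PowerSeries.C (t z z r)) (gaussElim M 1 i j) := by
    intro i j
    by_cases hij : (i : ℕ) < 1 ∨ (j : ℕ) < 1
    · rw [(gaussElim_invariant hM 1 hn).2 i j hij]
      exact Commute.zero_right _
    push Not at hij
    have := hinv ⟨i, hij.1⟩ ⟨j, hij.2⟩
    ext s
    rw [PowerSeries.coeff_C_mul, PowerSeries.coeff_mul_C]
    have e := congrArg (fun w => PowerSeries.coeff r (PowerSeries.coeff s w)) this.eq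
    simp only [Matrix.map_apply] at e
    rw [RTT.coeff_inU_mul_inV, RTT.coeff_inV_mul_inU] at e
    simpa [hMdef, RTT.seriesMatrix, lowerBlock] using e
  exact commute_gaussElim_of_pivots hM (s := Set.univ) (fun i _ j _ => hone i j) hpos i.2.le
    (fun _ _ _ => Set.mem_univ _) i (Set.mem_univ _) i (Set.mem_univ _)

/-- A subring which contains the coefficients of `t_{0,0}(u)` and the zero modes of adjacent
indices contains all `t_{i,j}^{(r)}`. -/
theorem mem_subring_of_generators (ht : IsRTTFamily t) (hn : 0 < n) (Z : Subring A)
    (h0 : ∀ r, t ⟨0, hn⟩ ⟨0, hn⟩ r ∈ Z)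
    (hadj : ∀ (k : ℕ) (hk : k + 1 < n), t ⟨k, by omega⟩ ⟨k + 1, hk⟩ 1 ∈ Z ∧
      t ⟨k + 1, hk⟩ ⟨k, by omega⟩ 1 ∈ Z) (i j : Fin n) (r : ℕ) : t i j r ∈ Z := by
  have comm : ∀ {a b : A}, a ∈ Z → b ∈ Z → a * b - b * a ∈ Z := fun ha hb =>
    Z.sub_mem (Z.mul_mem ha hb) (Z.mul_mem hb ha)
  set z : Fin n := ⟨0, hn⟩ with hz
  have hrow : ∀ (k : ℕ) (hk : k < n), t z ⟨k, hk⟩ 1 ∈ Z ∧ t ⟨k, hk⟩ z 1 ∈ Z := by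
    intro k
    induction k with
    | zero => exact fun _ => ⟨h0 1, h0 1⟩
    | succ k ih =>
      intro hk
      rcases Nat.eq_zero_or_pos k with rfl | hpos
      · exact hadj 0 hk
      obtain ⟨a1, a2⟩ := ih (by omega)
      obtain ⟨b1, b2⟩ := hadj k hk
      -- Longer zero modes are brackets of adjacent ones, as for matrix units.
      have e1 := ht.commutator_one z ⟨k, by omega⟩ ⟨k, by omega⟩ ⟨k + 1, hk⟩ 1
      have e2 := ht.commutator_one ⟨k + 1, hk⟩ ⟨k, by omega⟩ ⟨k, by omega⟩ z 1
      rw [if_pos rfl, if_neg (by simp [hz]), sub_zero] at e1 e2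
      exact ⟨e1 ▸ comm a1 b1, e2 ▸ comm b2 a2⟩
  have hcol : ∀ (i : Fin n) (r : ℕ), t i z r ∈ Z := by
    intro i r
    by_cases hi : i = z
    · rw [hi]; exact h0 r
    have e := ht.commutator_one i z z z r
    rw [if_pos rfl, if_neg hi, sub_zero] at e
    exact e ▸ comm (hrow i i.2).2 (h0 r)
  have e := ht.commutator_one z j i z r
  have e2 : t i j r = (t i z r * t z j 1 - t z j 1 * t i z r) + if i = j then t z z r else 0 := by
    rw [if_pos rfl] at e
    rw [← neg_sub, e]
    abel
  rw [e2]
  refine Z.add_mem (comm (hcol i r) (hrow j j.2).1) ?_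
  split_ifs
  · exact h0 r
  · exact Z.zero_mem

variable [Algebra ℂ A]

/-- The zero modes with indices `k, k + 1` commute with `D_k(u - k) D_{k+1}(u - k - 1)`. -/
theorem commute_shift_mul_shift (ht : IsRTTFamily t) {k : ℕ} (hk : k + 1 < n) {a b : Fin n}
    (hab : a = ⟨k, by omega⟩ ∧ b = ⟨k + 1, hk⟩ ∨ a = ⟨k + 1, hk⟩ ∧ b = ⟨k, by omega⟩) :
    Commute (PowerSeries.C (t a b 1))
      (Yangian.shift (k : ℂ) (gaussDiag (RTT.seriesMatrix t) ⟨k, by omega⟩) *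
        Yangian.shift ((k + 1 : ℕ) : ℂ) (gaussDiag (RTT.seriesMatrix t) ⟨k + 1, hk⟩)) := by
  set p : {i : Fin n // k ≤ (i : ℕ)} := ⟨⟨k, by omega⟩, le_rfl⟩ with hp
  set q : {i : Fin n // k ≤ (i : ℕ)} := ⟨⟨k + 1, hk⟩, Nat.le_succ k⟩ with hq
  have hpq : p ≠ q := by simp [hp, hq]
  set M := RTT.seriesMatrix t with hMdef
  have hM := ht.constantCoeff_seriesMatrix
  have hkn : k ≤ n := by omega
  obtain ⟨S, h1, h2⟩ := exists_inverse hM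
  have map1 : ∀ (f : A⟦X⟧ →+* A⟦X⟧) {κ : Type} [Fintype κ] [DecidableEq κ]
      {U V : Matrix κ κ A⟦X⟧}, U * V = 1 → U.map f * V.map f = 1 := by
    intro f κ _ _ U V hUV
    rw [← Matrix.map_mul, hUV, Matrix.map_one _ (map_zero f) (map_one f)]
  set N := lowerBlock (gaussElim M k) k with hN
  have hl := lowerBlock_mul_lowerBlock hM h1 k hkn
  have hl' := lowerBlock_mul_lowerBlock' hM h2 k hkn
  set f := Yangian.shiftHom A (k : ℂ) with hf
  set g := Yangian.shiftHom A ((k : ℂ) + 1) with hg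
  have H : RTT.Pair 1 1 (N.map f) (N.map g) :=
    (ht.pair_shift (k : ℂ)).schur (fun b => Commute.one_left b) (fun b => Commute.one_left b)
      (map1 f h1) (map1 f h2) (map1 g h1) (map1 g h2) Subtype.val
      (map1 f hl) (map1 f hl') (map1 g hl) (map1 g hl')
  have hpp : PowerSeries.constantCoeff (gaussElim M k ⟨k, by omega⟩ ⟨k, by omega⟩) =
      ((1 : Aˣ) : A) := gaussDiag_constantCoeff hM ⟨k, by omega⟩
  have eD : gaussDiag M ⟨k + 1, hk⟩ = N q q - N q p * PowerSeries.invOfUnit (N p p) 1 * N p q :=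
    gaussElim_succ (M := M) ⟨k, by omega⟩ ⟨k + 1, hk⟩ ⟨k + 1, hk⟩
  have eD' : gaussDiag M ⟨k, by omega⟩ = N p p := rfl
  -- The vanishing minor with column `p` repeated lets `N_{p,p}(u-k)` pass `N_{q,p}(u-k-1)` and
  -- cancel the shifted inverse pivot in `D_{k+1}(u-k-1)`.
  have hcol : f (N p p) * g (N q p) = f (N q p) * g (N p p) := by
    have := H p p q p
    simp only [one_mul, Matrix.map_apply] at this
    rw [← sub_eq_zero] at this ⊢
    rw [← this]; abel
  have hginv : g (N p p) * g (PowerSeries.invOfUnit (N p p) 1) = 1 := by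
    rw [← map_mul, PowerSeries.mul_invOfUnit (N p p) 1 hpp, map_one]
  have hprod : Yangian.shift (k : ℂ) (gaussDiag M ⟨k, by omega⟩) *
        Yangian.shift ((k + 1 : ℕ) : ℂ) (gaussDiag M ⟨k + 1, hk⟩) =
      (N.map f) p p * (N.map g) q q - (N.map f) q p * (N.map g) p q := by
    rw [eD, eD', ← Yangian.shiftHom_apply, ← Yangian.shiftHom_apply, Nat.cast_add, Nat.cast_one]
    simp only [Matrix.map_apply, map_sub, map_mul, mul_sub]
    rw [← hf, ← hg]
    congr 1
    rw [mul_assoc, ← mul_assoc (f (N p p)), hcol, mul_assoc, ← mul_assoc (g (N p p)), hginv,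
      one_mul]
  rw [hprod]
  have hc : ∀ d : ℂ, Yangian.shiftHom A d (PowerSeries.C (t a b 1)) = PowerSeries.C (t a b 1) :=
    fun d => Yangian.shift_C d _
  refine ZeroMode.commute_minor H hpq ?_
  rcases hab with ⟨rfl, rfl⟩ | ⟨rfl, rfl⟩
  · left
    have hz : ZeroMode _ p q N := (ht.zeroMode (p : Fin n) q).lowerBlock_gaussElim hM hkn
    exact ⟨hc k ▸ hz.map f, hc (k + 1) ▸ hz.map g⟩
  · right
    have hz : ZeroMode _ q p N := (ht.zeroMode (q : Fin n) p).lowerBlock_gaussElim hM hkn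
    exact ⟨hc k ▸ hz.map f, hc (k + 1) ▸ hz.map g⟩

end IsRTTFamily

/-! ### Centrality of the coefficients of `C_n(u)` in the Yangian. -/

namespace Yangian

theorem T_zero (n : ℕ) (i j : Fin n) : T n i j 0 = if i = j then 1 else 0 := by
  by_cases h : i = j <;> simp [T, yangianGen, h]

theorem isRTTFamily_T (n : ℕ) : IsRTTFamily (T n) := by
  refine IsRTTFamily.of_sum (T_zero n) fun i j h k r s => ?_
  have := RingQuot.mkAlgHom_rel ℂ (YangianRel.rtt i j h k r s)
  simp only [map_sub, map_mul, map_sum] at this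
  exact this

theorem induction_T {n : ℕ} (Z : Subalgebra ℂ (Yangian n)) (h : ∀ i j r, T n i j r ∈ Z) :
    Z = ⊤ := by
  rw [eq_top_iff]
  rintro y -
  obtain ⟨x, rfl⟩ := RingQuot.mkAlgHom_surjective ℂ (YangianRel n) y
  induction x using FreeAlgebra.induction with
  | grade0 c => rw [AlgHom.commutes]; exact Z.algebraMap_mem c
  | grade1 x => exact h x.1 x.2.1 (x.2.2 + 1)
  | mul a b ha hb => rw [map_mul]; exact Z.mul_mem ha hb
  | add a b ha hb => rw [map_add]; exact Z.add_mem ha hb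

theorem commute_T_CSeries {n : ℕ} (i j : Fin n) (r : ℕ) :
    Commute (PowerSeries.C (T n i j r)) (CSeries n) := by
  have ht := isRTTFamily_T n
  have hn : 0 < n := i.pos
  have hD : ∀ i, D n i = gaussDiag (RTT.seriesMatrix (T n)) i := fun _ => rfl
  have shiftC : ∀ {a : Yangian n} {f : (Yangian n)⟦X⟧} (c : ℂ), Commute (PowerSeries.C a) f →
      Commute (PowerSeries.C a) (shift c f) := by
    intro a f c h
    have := h.map (shiftHom (Yangian n) c)
    rwa [shiftHom_apply, shiftHom_apply, shift_C] at this
  let Z : Subring (Yangian n) :=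
    (Subring.centralizer {CSeries n}).comap (PowerSeries.C (R := Yangian n))
  have hZ : ∀ y, y ∈ Z ↔ Commute (PowerSeries.C y) (CSeries n) := by
    intro y
    change PowerSeries.C y ∈ Subring.centralizer _ ↔ _
    rw [Subring.mem_centralizer_iff]
    exact ⟨fun h => (h _ rfl).symm, fun h x hx => by rw [Set.mem_singleton_iff.1 hx]; exact h.symm⟩
  rw [← hZ]
  refine ht.mem_subring_of_generators hn Z ?_ ?_ i j r
  · intro r
    rw [hZ]
    refine Commute.list_prod_right _ _ fun x hx => ?_
    obtain ⟨i, rfl⟩ := (List.mem_ofFn' _ _).1 hx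
    exact shiftC _ (ht.commute_gaussDiag_zero hn r i)
  · intro k hk
    have key : ∀ a b : Fin n, (a = ⟨k, by omega⟩ ∧ b = ⟨k + 1, hk⟩ ∨
        a = ⟨k + 1, hk⟩ ∧ b = ⟨k, by omega⟩) → T n a b 1 ∈ Z := by
      intro a b hab
      rw [hZ]
      refine commute_ofFn_prod _ k hk ?_ (ht.commute_shift_mul_shift hk hab)
      intro i h1 h2
      refine shiftC _ ?_
      rcases lt_or_gt_of_ne h1 with h | h
      · refine ht.commute_gaussDiag_of_gt ?_ ?_ <;>
          rcases hab with ⟨rfl, rfl⟩ | ⟨rfl, rfl⟩ <;> rw [Fin.lt_def] <;> simp <;> omega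
      · refine ht.commute_gaussDiag_of_lt ?_ ?_ <;>
          rcases hab with ⟨rfl, rfl⟩ | ⟨rfl, rfl⟩ <;> rw [Fin.lt_def] <;> simp <;> omega
    exact ⟨key _ _ (Or.inl ⟨rfl, rfl⟩), key _ _ (Or.inr ⟨rfl, rfl⟩)⟩

theorem C_mem_center (n r : ℕ) : C n r ∈ Subalgebra.center ℂ (Yangian n) := by
  have hT : ∀ i j s, Commute (T n i j s) (C n r) := by
    intro i j s
    have := congrArg (PowerSeries.coeff r) (commute_T_CSeries i j s).eq
    rwa [PowerSeries.coeff_C_mul, PowerSeries.coeff_mul_C] at this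
  have := induction_T (Subalgebra.centralizer ℂ {C n r}) (fun i j s => by
    rw [Subalgebra.mem_centralizer_iff]
    intro g hg
    rw [Set.mem_singleton_iff.1 hg]
    exact (hT i j s).eq.symm)
  rw [Subalgebra.mem_center_iff]
  intro y
  have hy : y ∈ Subalgebra.centralizer ℂ {C n r} := this ▸ Algebra.mem_top
  exact ((Subalgebra.mem_centralizer_iff ℂ).1 hy _ rfl).symm

end Yangian

/-! ### The universal property and the evaluation coproduct -/

namespace IsRTTFamily

variable {A B : Type*} [Ring A] [Ring B] {n : ℕ}

theorem map {t : Fin n → Fin n → ℕ → A} (ht : IsRTTFamily t) (f : A →+* B) :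
    IsRTTFamily fun i j r => f (t i j r) := by
  refine ⟨fun i j => ?_, fun i j h k r s => ?_⟩
  · rw [ht.zero]
    split_ifs <;> simp
  · simpa using congrArg f (ht.rtt i j h k r s)

theorem commute_inU_inV {f g : A⟦X⟧}
    (h : ∀ r s, Commute (PowerSeries.coeff r f) (PowerSeries.coeff s g)) :
    Commute (RTT.inU A f) (RTT.inV A g) :=
  RTT.ext_coeff fun r s => by
    rw [RTT.coeff_inU_mul_inV, RTT.coeff_inV_mul_inU]
    exact h r s

/-- The product of the generating matrices of two families with commuting entries. -/
theorem mul {t t' t'' : Fin n → Fin n → ℕ → A} (ht : IsRTTFamily t) (ht' : IsRTTFamily t')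
    (hc : ∀ i j r h k s, Commute (t i j r) (t' h k s))
    (h : RTT.seriesMatrix t'' = RTT.seriesMatrix t * RTT.seriesMatrix t') : IsRTTFamily t'' := by
  have h0 : ∀ i j, t'' i j 0 = if i = j then 1 else 0 := by
    intro i j
    have := congrArg (PowerSeries.coeff 0) (congrFun (congrFun h i) j)
    simp only [RTT.seriesMatrix, Matrix.of_apply, PowerSeries.coeff_mk, Matrix.mul_apply,
      map_sum] at this
    simp only [PowerSeries.coeff_zero_eq_constantCoeff_apply, map_mul] at this
    simp only [← PowerSeries.coeff_zero_eq_constantCoeff_apply, PowerSeries.coeff_mk, ht.zero,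
      ht'.zero] at this
    simpa using this
  rw [RTT.pair_seriesMatrix_iff h0, h, Matrix.map_mul, Matrix.map_mul]
  have hx := RTT.commute_xVar (A := A)
  have hy := RTT.commute_yVar (A := A)
  refine RTT.Pair.mul (fun b => (hx b).mul_left (hy b)) (fun b => (hy b).sub_left (hx b))
    ((RTT.pair_seriesMatrix_iff ht.zero).1 ht) ((RTT.pair_seriesMatrix_iff ht'.zero).1 ht') ?_ ?_
  · intro i j h k
    refine commute_inU_inV fun r s => ?_
    simpa [RTT.seriesMatrix] using hc i j r h k s
  · intro i j h k
    refine (commute_inU_inV fun r s => ?_).symm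
    simpa [RTT.seriesMatrix] using (hc i j s h k r).symm

/-- The family `δ_{i,j} + e_{i,j} (u - a)⁻¹` with `a` the polynomial variable. -/
theorem evaluation (A : Type*) [Ring A] (n : ℕ) :
    IsRTTFamily fun (i j : Fin n) (r : ℕ) => match r with
      | 0 => if i = j then (1 : Matrix (Fin n) (Fin n) (Polynomial A)) else 0
      | r + 1 => Matrix.single i j (Polynomial.X ^ r) := by
  refine ⟨fun i j => rfl, fun i j h k r s => ?_⟩
  have hs : ∀ (i j h k : Fin n) (x y : Polynomial A),
      Matrix.single i j x * Matrix.single h k y = if h = j then Matrix.single i k (x * y) else 0 := by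
    intro i j h k x y
    split_ifs with hh
    · subst hh; rw [Matrix.single_mul_single_same]
    · rw [Matrix.single_mul_single_of_ne _ _ _ _ (Ne.symm hh)]
  rcases r with _ | r <;> rcases s with _ | s
  · simp only [pow_zero]
    split_ifs <;> simp
  · simp only [pow_zero, hs]
    split_ifs <;> simp_all
  · simp only [pow_zero, hs]
    split_ifs <;> simp_all
  · simp only [hs]
    simp only [← pow_add]
    rw [show r + 1 + s = r + (s + 1) by omega, show s + (r + 1) = s + 1 + r by omega, add_comm s r]
    simp

end IsRTTFamily

namespace Yangian

variable {n : ℕ} {B : Type*} [Ring B] [Algebra ℂ B]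

/-- The universal property of the Yangian. -/
theorem exists_algHom {t : Fin n → Fin n → ℕ → B} (ht : IsRTTFamily t) :
    ∃ f : Yangian n →ₐ[ℂ] B, ∀ i j r, f (T n i j r) = t i j r := by
  set g : FreeAlgebra ℂ (Fin n × Fin n × ℕ) →ₐ[ℂ] B :=
    FreeAlgebra.lift ℂ fun x => t x.1 x.2.1 (x.2.2 + 1) with hg
  have hgen : ∀ i j r, g (yangianGen n i j r) = t i j r := by
    rintro i j (_ | r)
    · rw [ht.zero]
      by_cases h : i = j <;> simp [yangianGen, h]
    · simp [yangianGen, hg]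
  have hrel : ∀ ⦃x y⦄, YangianRel n x y → g x = g y := by
    rintro _ _ ⟨i, j, h, k, r, s⟩
    simp only [map_sub, map_mul, map_sum, hgen]
    exact ht.commutator_eq_sum_min i j h k r s
  refine ⟨RingQuot.liftAlgHom ℂ ⟨g, hrel⟩, fun i j r => ?_⟩
  rw [T, RingQuot.liftAlgHom_mkAlgHom_apply]
  exact hgen i j r

/-- The composition of the coproduct with the evaluation homomorphism at a formal parameter. -/
theorem exists_evalCoproduct (n : ℕ) :
    ∃ Δ : Yangian n →ₐ[ℂ] Matrix (Fin n) (Fin n) (Polynomial (Yangian n)),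
      ∀ i j r a b, Δ (T n i j (r + 1)) a b =
        (if a = b then Polynomial.C (T n i j (r + 1)) else 0) +
          if j = b then ∑ p ∈ Finset.HasAntidiagonal.antidiagonal r,
            Polynomial.monomial p.2 (T n i a p.1) else 0 := by
  set t₁ : Fin n → Fin n → ℕ → Matrix (Fin n) (Fin n) (Polynomial (Yangian n)) := fun i j r =>
    (Matrix.scalar (Fin n)).comp Polynomial.C (T n i j r) with ht₁
  have h₁ : IsRTTFamily t₁ := (isRTTFamily_T n).map _
  have h₂ := IsRTTFamily.evaluation (Yangian n) n
  set t₂ : Fin n → Fin n → ℕ → Matrix (Fin n) (Fin n) (Polynomial (Yangian n)) := _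
  change IsRTTFamily t₂ at h₂
  -- The coefficients of `T(u) (1 + e (u - x)⁻¹)`, where `e` has the matrix unit `e_{i,j}` in
  -- position `(i, j)`.
  set t : Fin n → Fin n → ℕ → Matrix (Fin n) (Fin n) (Polynomial (Yangian n)) := fun i j r =>
    ∑ k, ∑ p ∈ Finset.HasAntidiagonal.antidiagonal r, t₁ i k p.1 * t₂ k j p.2 with ht
  have h : IsRTTFamily t := by
    refine h₁.mul h₂ ?_ ?_
    · intro i j r h k s
      refine commute_entries_iff.1 fun a b => ?_
      rcases s with _ | s
      · change Commute _ ((if h = k then 1 else 0 : Matrix (Fin n) (Fin n) (Polynomial (Yangian n))) a b)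
        split_ifs with hhk
        · by_cases hab : a = b
          · rw [hab, Matrix.one_apply_eq]; exact Commute.one_right _
          · rw [Matrix.one_apply_ne hab]; exact Commute.zero_right _
        · exact Commute.zero_right _
      · simp only [Matrix.single_apply]
        split_ifs
        · exact (Polynomial.commute_X_pow _ _).symm
        · exact Commute.zero_right _
    · ext i j r : 3
      simp only [RTT.seriesMatrix, Matrix.of_apply, PowerSeries.coeff_mk, Matrix.mul_apply,
        map_sum, PowerSeries.coeff_mul, ht]
  obtain ⟨Δ, hΔ⟩ := exists_algHom h
  refine ⟨Δ, fun i j r a b => ?_⟩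
  rw [hΔ]
  have e1 : ∀ k q, t₂ k j (q + 1) = Matrix.single k j (Polynomial.X ^ q) := fun _ _ => rfl
  have e2 : ∀ k, t₂ k j 0 = if k = j then 1 else 0 := fun _ => rfl
  have e3 : ∀ k q (M : Matrix (Fin n) (Fin n) (Polynomial (Yangian n))),
      (t₁ i k q * M) a b = Polynomial.C (T n i k q) * M a b := by
    intro k q M
    exact Matrix.diagonal_mul _ _ _ _
  simp only [ht, Finset.Nat.sum_antidiagonal_succ', Finset.sum_add_distrib,
    Matrix.sum_apply, e1, e2, e3, Matrix.single_apply]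
  congr 1
  · rw [Finset.sum_eq_single j]
    · by_cases hab : a = b <;> simp [Matrix.one_apply, hab]
    · intro k _ hk; simp [hk]
    · simp
  · rw [Finset.sum_eq_single a]
    · by_cases hjb : j = b <;> simp [hjb, Polynomial.C_mul_X_pow_eq_monomial]
    · intro k _ hk; simp [hk]
    · simp

end Yangian

/-! ### The loop filtration -/

namespace LoopFiltration

variable {A : Type*} [Ring A] {n : ℕ} (t : Fin n → Fin n → ℕ → A)

/-- The product of the generators `t_{i,j}^{(r+1)}` along a list of letters `(i, j, r)`. -/
def word (v : List (Fin n × Fin n × ℕ)) : A := (v.map fun x => t x.1 x.2.1 (x.2.2 + 1)).prod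

/-- The loop degree of a word, the letter `(i, j, r)` having degree `r`. -/
def degree (v : List (Fin n × Fin n × ℕ)) : ℤ := (v.map fun x => (x.2.2 : ℤ)).sum

theorem degree_nonneg (v : List (Fin n × Fin n × ℕ)) : 0 ≤ degree v := by
  refine List.sum_nonneg fun x hx => ?_
  obtain ⟨y, -, rfl⟩ := List.mem_map.1 hx
  exact Int.natCast_nonneg _

theorem word_append (v w : List (Fin n × Fin n × ℕ)) : word t (v ++ w) = word t v * word t w := by
  simp [word]

theorem degree_append (v w : List (Fin n × Fin n × ℕ)) :
    degree (v ++ w) = degree v + degree w := by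
  simp [degree]

/-- The scalar matrix with entries constant polynomials. -/
noncomputable def const (n : ℕ) (y : A) : Matrix (Fin n) (Fin n) (Polynomial A) :=
  Matrix.diagonal fun _ => Polynomial.C y

theorem const_mul_apply (y : A) (M : Matrix (Fin n) (Fin n) (Polynomial A)) (a b : Fin n) (s : ℕ) :
    ((const n y * M) a b).coeff s = y * (M a b).coeff s := by
  rw [const, Matrix.diagonal_mul, Polynomial.coeff_C_mul]

theorem mul_const_apply (y : A) (M : Matrix (Fin n) (Fin n) (Polynomial A)) (a b : Fin n) (s : ℕ) :
    ((M * const n y) a b).coeff s = (M a b).coeff s * y := by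
  rw [const, Matrix.mul_diagonal, Polynomial.coeff_mul_C]

theorem const_apply_coeff (y : A) (a b : Fin n) (s : ℕ) :
    (const n y a b).coeff s = if a = b ∧ s = 0 then y else 0 := by
  by_cases hab : a = b
  · simp [const, hab, Polynomial.coeff_C]
  · simp [const, hab]

theorem const_mul (x y : A) : const n (x * y) = const n x * const n y := by
  simp [const, Matrix.diagonal_mul_diagonal]

variable [Algebra ℂ A]

/-- The span of the words of loop degree at most `l`. -/
def L (l : ℤ) : Submodule ℂ A := Submodule.span ℂ (word t '' {v | degree v ≤ l})

/-- The span of the words of loop degree less than `l` and of those of loop degree `l` and length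
at most `q`. -/
def W (q l : ℤ) : Submodule ℂ A :=
  Submodule.span ℂ (word t '' {v | degree v < l ∨ degree v = l ∧ (v.length : ℤ) ≤ q})

variable {t}

theorem word_mem_L {v : List (Fin n × Fin n × ℕ)} {l : ℤ} (h : degree v ≤ l) : word t v ∈ L t l :=
  Submodule.subset_span ⟨v, h, rfl⟩

theorem word_mem_W (v : List (Fin n × Fin n × ℕ)) : word t v ∈ W t v.length (degree v) :=
  Submodule.subset_span ⟨v, Or.inr ⟨rfl, le_rfl⟩, rfl⟩

theorem L_mono {l m : ℤ} (h : l ≤ m) : L t l ≤ L t m :=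
  Submodule.span_mono (Set.image_mono fun _ hv => le_trans hv h)

theorem L_le_W {l m : ℤ} (h : l < m) (q : ℤ) : L t l ≤ W t q m :=
  Submodule.span_mono (Set.image_mono fun _ hv => Or.inl (lt_of_le_of_lt hv h))

theorem W_le_L (q l : ℤ) : W t q l ≤ L t l := by
  refine Submodule.span_mono (Set.image_mono fun v hv => ?_)
  rcases hv with h | h
  · exact h.le
  · exact h.1.le

theorem W_mono {q q' : ℤ} (h : q ≤ q') (l : ℤ) : W t q l ≤ W t q' l := by
  refine Submodule.span_mono (Set.image_mono fun v hv => ?_)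
  rcases hv with hv | hv
  · exact Or.inl hv
  · exact Or.inr ⟨hv.1, hv.2.trans h⟩

theorem L_eq_bot {l : ℤ} (h : l < 0) : L t l = ⊥ := by
  rw [L, Submodule.span_eq_bot]
  rintro _ ⟨v, hv, rfl⟩
  exact absurd (degree_nonneg v) (not_le.2 (lt_of_le_of_lt hv h))

theorem L_mul {l m : ℤ} {a b : A} (ha : a ∈ L t l) (hb : b ∈ L t m) : a * b ∈ L t (l + m) := by
  have h : L t l * L t m ≤ L t (l + m) := by
    rw [L, L, Submodule.span_mul_span, Submodule.span_le]
    rintro _ ⟨_, ⟨v, hv, rfl⟩, _, ⟨w, hw, rfl⟩, rfl⟩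
    change word t v * word t w ∈ L t (l + m)
    rw [← word_append]
    refine word_mem_L ?_
    rw [degree_append]
    exact add_le_add hv hw
  exact h (Submodule.mul_mem_mul ha hb)

theorem W_mul {q q' l m : ℤ} {a b : A} (ha : a ∈ W t q l) (hb : b ∈ W t q' m) :
    a * b ∈ W t (q + q') (l + m) := by
  have h : W t q l * W t q' m ≤ W t (q + q') (l + m) := by
    rw [W, W, Submodule.span_mul_span, Submodule.span_le]
    rintro _ ⟨_, ⟨v, hv, rfl⟩, _, ⟨w, hw, rfl⟩, rfl⟩
    change word t v * word t w ∈ W t (q + q') (l + m)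
    rw [← word_append]
    refine Submodule.subset_span ⟨_, ?_, rfl⟩
    simp only [Set.mem_ofPred_eq, degree_append, List.length_append, Nat.cast_add] at hv hw ⊢
    omega
  exact h (Submodule.mul_mem_mul ha hb)

theorem exists_mem_W {l : ℤ} {y : A} (hy : y ∈ L t l) : ∃ q : ℕ, y ∈ W t q l := by
  induction hy using Submodule.span_induction with
  | mem x hx =>
    obtain ⟨v, hv, rfl⟩ := hx
    rcases lt_or_eq_of_le (show degree v ≤ l from hv) with h | h
    · exact ⟨0, Submodule.subset_span ⟨v, Or.inl h, rfl⟩⟩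
    · exact ⟨v.length, Submodule.subset_span ⟨v, Or.inr ⟨h, le_rfl⟩, rfl⟩⟩
  | zero => exact ⟨0, Submodule.zero_mem _⟩
  | add x y _ _ hx hy =>
    obtain ⟨q, hq⟩ := hx
    obtain ⟨q', hq'⟩ := hy
    refine ⟨max q q', Submodule.add_mem _ (W_mono ?_ _ hq) (W_mono ?_ _ hq')⟩
    · exact_mod_cast le_max_left q q'
    · exact_mod_cast le_max_right q q'
  | smul c x _ hx =>
    obtain ⟨q, hq⟩ := hx
    exact ⟨q, Submodule.smul_mem _ c hq⟩

theorem one_mem_L : (1 : A) ∈ L t 0 := by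
  have : (1 : A) = word t [] := rfl
  rw [this]
  exact word_mem_L le_rfl

theorem one_mem_W : (1 : A) ∈ W t 0 0 := by
  have : (1 : A) = word t [] := rfl
  rw [this]
  exact word_mem_W []

theorem gen_mem_W (i j : Fin n) (r : ℕ) : t i j (r + 1) ∈ W t 1 r := by
  have := word_mem_W (t := t) [(i, j, r)]
  simpa [word, degree] using this

theorem gen_mem_L (i j : Fin n) (r : ℕ) : t i j (r + 1) ∈ L t r := W_le_L _ _ (gen_mem_W i j r)

theorem gen_mem_L_sub_one (i j : Fin n) {r : ℕ} (hr : 0 < r) : t i j r ∈ L t ((r : ℤ) - 1) := by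
  obtain ⟨r, rfl⟩ : ∃ s, r = s + 1 := ⟨r - 1, by omega⟩
  simpa using gen_mem_L (t := t) i j r

theorem exists_mem_L (hgen : ∀ Z : Subalgebra ℂ A, (∀ i j r, t i j r ∈ Z) → Z = ⊤)
    (h0 : ∀ i j, t i j 0 = if i = j then 1 else 0) (y : A) : ∃ l : ℕ, y ∈ L t l := by
  let Z : Subalgebra ℂ A :=
    { carrier := {y | ∃ l : ℕ, y ∈ L t l}
      mul_mem' := by
        rintro a b ⟨l, hl⟩ ⟨m, hm⟩
        exact ⟨l + m, by rw [Nat.cast_add]; exact L_mul hl hm⟩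
      add_mem' := by
        rintro a b ⟨l, hl⟩ ⟨m, hm⟩
        exact ⟨l + m, Submodule.add_mem _ (L_mono (by omega) hl) (L_mono (by omega) hm)⟩
      algebraMap_mem' := fun c => ⟨0, by
        rw [Algebra.algebraMap_eq_smul_one]
        exact Submodule.smul_mem _ _ one_mem_L⟩ }
  have : Z = ⊤ := by
    refine hgen Z ?_
    rintro i j (_ | r)
    · rw [h0]
      split_ifs
      · exact Z.one_mem
      · exact Z.zero_mem
    · exact ⟨r, gen_mem_L i j r⟩
  have hy : y ∈ Z := this ▸ Algebra.mem_top
  exact hy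

/-- Only the summand `a = 0` reaches loop degree `r + s`, and it is linear in the generators. The
other summands are products of two generators of total degree `r + s - 1`. So a commutator loses a
letter to leading order. -/
theorem commutator_mem_W (ht : IsRTTFamily t) (i j h k : Fin n) (r s : ℕ) :
    t i j (r + 1) * t h k (s + 1) - t h k (s + 1) * t i j (r + 1) ∈ W t 1 (r + s) := by
  rw [ht.commutator_eq_sum]
  refine Submodule.sum_mem _ fun a ha => ?_
  have har := Finset.mem_range.1 ha
  rcases Nat.eq_zero_or_pos a with rfl | hpos
  · have e : r + 1 + (s + 1) - 1 - 0 = r + s + 1 := by omega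
    have hW := fun i j : Fin n => gen_mem_W (t := t) i j (r + s)
    rw [Nat.cast_add] at hW
    rw [e, ht.zero, ht.zero]
    refine Submodule.sub_mem _ ?_ ?_ <;> split_ifs <;> simp [hW]
  · have h1 : ∀ x y : Fin n, t x y a ∈ L t ((a : ℤ) - 1) := fun x y => gen_mem_L_sub_one x y hpos
    have h2 : ∀ x y : Fin n, t x y (r + 1 + (s + 1) - 1 - a) ∈
        L t (((r + 1 + (s + 1) - 1 - a : ℕ) : ℤ) - 1) := fun x y =>
      gen_mem_L_sub_one x y (by omega)
    exact Submodule.sub_mem _ (L_le_W (by omega) _ (L_mul (h1 _ _) (h2 _ _)))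
      (L_le_W (by omega) _ (L_mul (h2 _ _) (h1 _ _)))

/-! ### Matrices of polynomials with filtered coefficients -/

/-- The matrices of polynomials whose coefficients of degree `s` lie in the `(l - s)`-th step of a
filtration. -/
def matFil (F : ℤ → Submodule ℂ A) (l : ℤ) :
    Submodule ℂ (Matrix (Fin n) (Fin n) (Polynomial A)) where
  carrier := {M | ∀ a b (s : ℕ), (M a b).coeff s ∈ F (l - s)}
  add_mem' hM hN a b s := by
    rw [Matrix.add_apply, Polynomial.coeff_add]
    exact Submodule.add_mem _ (hM a b s) (hN a b s)
  zero_mem' a b s := by simp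
  smul_mem' c M hM a b s := by
    rw [Matrix.smul_apply, Polynomial.coeff_smul]
    exact Submodule.smul_mem _ c (hM a b s)

theorem matFil_mul {F F' F'' : ℤ → Submodule ℂ A}
    (hF : ∀ l m a b, a ∈ F l → b ∈ F' m → a * b ∈ F'' (l + m)) {l m : ℤ}
    {M N : Matrix (Fin n) (Fin n) (Polynomial A)} (hM : M ∈ matFil F l) (hN : N ∈ matFil F' m) :
    M * N ∈ matFil F'' (l + m) := by
  intro a b s
  rw [Matrix.mul_apply, Polynomial.finsetSum_coeff]
  refine Submodule.sum_mem _ fun c _ => ?_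
  rw [Polynomial.coeff_mul]
  refine Submodule.sum_mem _ fun p hp => ?_
  have hs := Finset.HasAntidiagonal.mem_antidiagonal.1 hp
  have := hF _ _ _ _ (hM a c p.1) (hN c b p.2)
  rwa [show l - p.1 + (m - p.2) = l + m - s by rw [← hs]; push_cast; ring] at this

theorem const_mem {F : ℤ → Submodule ℂ A} {l : ℤ} {y : A} (hy : y ∈ F l) :
    const n y ∈ matFil F l := by
  intro a b s
  rw [const_apply_coeff]
  split_ifs with h
  · rw [h.2]; simpa using hy
  · exact Submodule.zero_mem _

/-! ### The difference of the coproduct and the identity -/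

/-- `Δ(y) - y`. -/
noncomputable def diff (Δ : A →ₐ[ℂ] Matrix (Fin n) (Fin n) (Polynomial A)) (y : A) :
    Matrix (Fin n) (Fin n) (Polynomial A) := Δ y - const n y

/-- The property that `Δ` is the evaluation coproduct. -/
def IsEval (t : Fin n → Fin n → ℕ → A) (Δ : A →ₐ[ℂ] Matrix (Fin n) (Fin n) (Polynomial A)) :
    Prop :=
  ∀ i j r a b, Δ (t i j (r + 1)) a b = (if a = b then Polynomial.C (t i j (r + 1)) else 0) +
    if j = b then ∑ p ∈ Finset.HasAntidiagonal.antidiagonal r,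
      Polynomial.monomial p.2 (t i a p.1) else 0

variable {Δ : A →ₐ[ℂ] Matrix (Fin n) (Fin n) (Polynomial A)}

/-- The Leibniz rule for `Δ - 1`, with a quadratic error term that costs one further letter. -/
theorem diff_mul (x y : A) :
    diff Δ (x * y) = const n x * diff Δ y + diff Δ x * const n y + diff Δ x * diff Δ y := by
  simp only [diff, map_mul, const_mul, mul_sub, sub_mul]
  abel

theorem diff_one : diff Δ 1 = 0 := by
  simp [diff, const]

theorem diff_add (x y : A) : diff Δ (x + y) = diff Δ x + diff Δ y := by
  ext a b s
  simp only [diff, map_add, Matrix.sub_apply, Matrix.add_apply, Polynomial.coeff_sub,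
    Polynomial.coeff_add, const_apply_coeff]
  split_ifs <;> abel

theorem diff_smul (c : ℂ) (x : A) : diff Δ (c • x) = c • diff Δ x := by
  ext a b s
  simp only [diff, map_smul, Matrix.sub_apply, Matrix.smul_apply, Polynomial.coeff_sub,
    Polynomial.coeff_smul, const_apply_coeff, smul_sub]
  split_ifs <;> simp

theorem diff_zero : diff Δ 0 = 0 := by
  simpa using diff_smul (Δ := Δ) 0 0

theorem diff_gen_coeff (hΔ : IsEval t Δ) (i j a b : Fin n) (r s : ℕ) :
    (diff Δ (t i j (r + 1)) a b).coeff s = if j = b ∧ s ≤ r then t i a (r - s) else 0 := by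
  rw [diff, Matrix.sub_apply, hΔ, Polynomial.coeff_sub, Polynomial.coeff_add, const_apply_coeff]
  have e1 : (if a = b then Polynomial.C (t i j (r + 1)) else 0 : Polynomial A).coeff s =
      if a = b ∧ s = 0 then t i j (r + 1) else 0 := by
    by_cases hab : a = b <;> simp [hab, Polynomial.coeff_C]
  rw [e1, add_sub_cancel_left]
  by_cases hjb : j = b
  · simp only [hjb, true_and, if_true, Polynomial.finsetSum_coeff, Polynomial.coeff_monomial]
    by_cases hs : s ≤ r
    · rw [if_pos hs, Finset.sum_eq_single (r - s, s)]
      · simp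
      · rintro ⟨x, y⟩ hp hne
        have := Finset.HasAntidiagonal.mem_antidiagonal.1 hp
        rw [if_neg]
        rintro rfl
        exact hne (by simp only [Prod.mk.injEq, and_true]; simp only at this; omega)
      · intro h
        exact absurd (Finset.HasAntidiagonal.mem_antidiagonal.2 (by simp; omega)) h
    · rw [if_neg hs]
      refine Finset.sum_eq_zero fun p hp => ?_
      have := Finset.HasAntidiagonal.mem_antidiagonal.1 hp
      rw [if_neg (by omega)]
  · simp [hjb]

/-- The leading term of `Δ(t_{i,j}^{(r+1)}) - t_{i,j}^{(r+1)}`. -/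
theorem diff_gen_sub_mem (ht : IsRTTFamily t) (hΔ : IsEval t Δ) (i j : Fin n) (r : ℕ) :
    diff Δ (t i j (r + 1)) - Matrix.single i j (Polynomial.X ^ r) ∈ matFil (L t) (r - 1) := by
  intro a b s
  rw [Matrix.sub_apply, Polynomial.coeff_sub, diff_gen_coeff hΔ, Matrix.single_apply]
  have e1 : (if i = a ∧ j = b then (Polynomial.X ^ r : Polynomial A) else 0).coeff s =
      if (i = a ∧ j = b) ∧ s = r then 1 else 0 := by
    by_cases hab : i = a ∧ j = b
    · simp only [hab, and_self, if_true, true_and, Polynomial.coeff_X_pow]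
    · simp [hab]
  rw [e1]
  by_cases hs : s < r
  · rw [if_neg (by omega : ¬ ((i = a ∧ j = b) ∧ s = r)), sub_zero]
    split_ifs
    · refine L_mono ?_ (gen_mem_L_sub_one i a (show 0 < r - s by omega))
      omega
    · exact Submodule.zero_mem _
  · have : ((if j = b ∧ s ≤ r then t i a (r - s) else 0) -
        if (i = a ∧ j = b) ∧ s = r then 1 else 0 : A) = 0 := by
      by_cases hsr : s = r
      · subst hsr
        simp only [le_refl, and_true, Nat.sub_self, ht.zero]
        by_cases hjb : j = b <;> by_cases hia : i = a <;> simp [hjb, hia]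
      · rw [if_neg (by omega), if_neg (by omega), sub_zero]
    rw [this]
    exact Submodule.zero_mem _

theorem single_mem (i j : Fin n) (r : ℕ) :
    Matrix.single i j (Polynomial.X ^ r) ∈ matFil (W t 0) (r : ℤ) := by
  intro a b s
  rw [Matrix.single_apply]
  split_ifs with h
  · rw [Polynomial.coeff_X_pow]
    split_ifs with hs
    · rw [hs, sub_self]; exact one_mem_W
    · exact Submodule.zero_mem _
  · simp

theorem matFil_mono {F F' : ℤ → Submodule ℂ A} {l l' : ℤ}
    (h : ∀ s : ℕ, F (l - s) ≤ F' (l' - s)) : matFil (n := n) F l ≤ matFil F' l' :=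
  fun _ hM a b s => h s (hM a b s)

theorem diff_gen_mem (ht : IsRTTFamily t) (hΔ : IsEval t Δ) (i j : Fin n) (r : ℕ) :
    diff Δ (t i j (r + 1)) ∈ matFil (W t 0) r := by
  rw [← sub_add_cancel (diff Δ (t i j (r + 1))) (Matrix.single i j (Polynomial.X ^ r))]
  exact Submodule.add_mem _
    (matFil_mono (fun s => L_le_W (by omega) _) (diff_gen_sub_mem ht hΔ i j r)) (single_mem i j r)

/-- Like a derivative, `Δ(y) - y` removes at least one letter to leading order, while `x^s` carries
loop degree `s`. -/
theorem diff_word_mem (ht : IsRTTFamily t) (hΔ : IsEval t Δ) (v : List (Fin n × Fin n × ℕ)) :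
    diff Δ (word t v) ∈ matFil (W t (v.length - 1)) (degree v) := by
  induction v with
  | nil =>
    have : word t ([] : List (Fin n × Fin n × ℕ)) = 1 := rfl
    rw [this, diff_one]
    exact Submodule.zero_mem _
  | cons x v ih =>
    have hw : word t (x :: v) = t x.1 x.2.1 (x.2.2 + 1) * word t v := by simp [word]
    have hd : degree (x :: v) = x.2.2 + degree v := by simp [degree]
    have mulW : ∀ q q' l m a b, a ∈ W t q l → b ∈ W t q' m → a * b ∈ W t (q + q') (l + m) :=
      fun q q' l m a b => W_mul
    have hx := diff_gen_mem ht hΔ x.1 x.2.1 x.2.2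
    rw [hw, hd, diff_mul]
    refine Submodule.add_mem _ (Submodule.add_mem _ ?_ ?_) ?_
    · have := matFil_mul (mulW _ _) (const_mem (n := n) (F := W t 1)
        (gen_mem_W x.1 x.2.1 x.2.2)) ih
      exact matFil_mono (fun s => W_mono (by simp) _) this
    · have := matFil_mul (mulW _ _) hx (const_mem (n := n) (F := W t v.length) (word_mem_W v))
      exact matFil_mono (fun s => W_mono (by simp) _) this
    · have := matFil_mul (mulW _ _) hx ih
      exact matFil_mono (fun s => W_mono (by simp) _) this

theorem diff_mem_W (ht : IsRTTFamily t) (hΔ : IsEval t Δ) {q l : ℤ} {y : A} (hy : y ∈ W t q l) :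
    diff Δ y ∈ matFil (W t (q - 1)) l := by
  induction hy using Submodule.span_induction with
  | mem x hx =>
    obtain ⟨v, hv, rfl⟩ := hx
    have := diff_word_mem ht hΔ v
    rcases hv with hv | hv
    · exact matFil_mono (fun s => (W_le_L _ _).trans (L_le_W (by omega) _)) this
    · rw [← hv.1]
      exact matFil_mono (fun s => W_mono (by omega) _) this
  | zero => rw [diff_zero]; exact Submodule.zero_mem _
  | add x y _ _ hx hy => rw [diff_add]; exact Submodule.add_mem _ hx hy
  | smul c x _ hx => rw [diff_smul]; exact Submodule.smul_mem _ _ hx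

theorem diff_mem_L (ht : IsRTTFamily t) (hΔ : IsEval t Δ) {l : ℤ} {y : A} (hy : y ∈ L t l) :
    diff Δ y ∈ matFil (L t) l := by
  obtain ⟨q, hq⟩ := exists_mem_W hy
  exact matFil_mono (fun s => W_le_L _ _) (diff_mem_W ht hΔ hq)

theorem eval_eq_diff_add (y : A) : Δ y = diff Δ y + const n y := by
  rw [diff, sub_add_cancel]

theorem eval_mem_L (ht : IsRTTFamily t) (hΔ : IsEval t Δ) {l : ℤ} {y : A} (hy : y ∈ L t l) :
    Δ y ∈ matFil (L t) l := by
  rw [eval_eq_diff_add]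
  exact Submodule.add_mem _ (diff_mem_L ht hΔ hy) (const_mem hy)

/-! ### The Euler operator -/

/-- The Euler operator `∑ t_{i,j}^{(s+1)} ∂_{i,j,s}`, the sum being over `s < N`. -/
noncomputable def euler (t : Fin n → Fin n → ℕ → A)
    (Δ : A →ₐ[ℂ] Matrix (Fin n) (Fin n) (Polynomial A)) (N : ℕ) (y : A) : A :=
  ∑ i, ∑ j, ∑ s ∈ Finset.range N, t i j (s + 1) * (diff Δ y i j).coeff s

theorem euler_add (N : ℕ) (x y : A) : euler t Δ N (x + y) = euler t Δ N x + euler t Δ N y := by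
  simp [euler, diff_add, mul_add, Finset.sum_add_distrib]

theorem euler_smul (N : ℕ) (c : ℂ) (x : A) : euler t Δ N (c • x) = c • euler t Δ N x := by
  simp [euler, diff_smul, Finset.smul_sum]

theorem euler_word (ht : IsRTTFamily t) (hΔ : IsEval t Δ) (v : List (Fin n × Fin n × ℕ)) {N : ℕ}
    (hN : degree v < N) :
    euler t Δ N (word t v) - (v.length : ℂ) • word t v ∈ W t (v.length - 1) (degree v) := by
  induction v with
  | nil =>
    have : word t ([] : List (Fin n × Fin n × ℕ)) = 1 := rfl
    rw [this]
    simp [euler, diff_one]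
  | cons x v ih =>
    obtain ⟨i₀, j₀, r⟩ := x
    set g := t i₀ j₀ (r + 1) with hg
    set w := word t v with hw
    have hxw : word t ((i₀, j₀, r) :: v) = g * w := by simp [word, hg, hw]
    have hd : degree ((i₀, j₀, r) :: v) = r + degree v := by simp [degree]
    have hnn := degree_nonneg v
    have hlen : ((((i₀, j₀, r) :: v).length : ℕ) : ℤ) - 1 = v.length := by simp
    rw [hd] at hN ⊢
    rw [hlen, hxw]
    have hgW : g ∈ W t 1 r := gen_mem_W i₀ j₀ r
    have hdw := diff_word_mem ht hΔ v
    have hdx := diff_gen_mem ht hΔ i₀ j₀ r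
    have hdx' := diff_gen_sub_mem ht hΔ i₀ j₀ r
    rw [← hg] at hdx hdx'
    rw [← hw] at hdw
    set Xr : Matrix (Fin n) (Fin n) (Polynomial A) := Matrix.single i₀ j₀ (Polynomial.X ^ r) with hXr
    have mulW : ∀ q q' l m a b, a ∈ W t q l → b ∈ W t q' m → a * b ∈ W t (q + q') (l + m) :=
      fun q q' l m a b => W_mul
    have hprod := matFil_mul (mulW _ _) hdx hdw
    -- Differentiating the first letter and multiplying by the generator restores the word; `N`
    -- exceeds the degree, so that `s = r` is in range.
    have hX : ∑ i, ∑ j, ∑ s ∈ Finset.range N,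
        t i j (s + 1) * (Xr i j).coeff s * w = g * w := by
      rw [Finset.sum_eq_single i₀, Finset.sum_eq_single j₀, Finset.sum_eq_single r]
      · simp [hg, hXr]
      · intro s _ hs
        simp [hXr, Polynomial.coeff_X_pow, hs]
      · intro h
        exact absurd (Finset.mem_range.2 (by omega)) h
      · intro j _ hj
        refine Finset.sum_eq_zero fun s _ => ?_
        rw [hXr, Matrix.single_apply, if_neg (fun h => hj h.2.symm)]
        simp
      · simp
      · intro i _ hi
        refine Finset.sum_eq_zero fun j _ => Finset.sum_eq_zero fun s _ => ?_
        rw [hXr, Matrix.single_apply, if_neg (fun h => hi h.1.symm)]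
        simp
      · simp
    have key : ∀ i j (s : ℕ), t i j (s + 1) * (diff Δ (g * w) i j).coeff s -
        (g * (t i j (s + 1) * (diff Δ w i j).coeff s) + t i j (s + 1) *
          (Xr i j).coeff s * w) ∈ W t v.length (r + degree v) := by
      intro i j s
      -- Three errors remain: a commutator, which loses a letter; the lower terms of `Δ(g) - g`, of
      -- smaller loop degree; and the quadratic term of the Leibniz rule.
      have e : t i j (s + 1) * (diff Δ (g * w) i j).coeff s -
        (g * (t i j (s + 1) * (diff Δ w i j).coeff s) + t i j (s + 1) *
          (Xr i j).coeff s * w) =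
          (t i j (s + 1) * g - g * t i j (s + 1)) * (diff Δ w i j).coeff s +
          t i j (s + 1) * (((diff Δ g - Xr) i j).coeff s * w) +
          t i j (s + 1) * ((diff Δ g * diff Δ w) i j).coeff s := by
        rw [diff_mul]
        simp only [Matrix.add_apply, Matrix.sub_apply, Polynomial.coeff_add, Polynomial.coeff_sub,
          const_mul_apply, mul_const_apply, sub_mul, mul_sub, mul_add, mul_assoc]
        abel
      rw [e]
      refine Submodule.add_mem _ (Submodule.add_mem _ ?_ ?_) ?_
      · have := W_mul (commutator_mem_W ht i j i₀ j₀ s r) (hdw i j s)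
        rwa [show (1 : ℤ) + (v.length - 1) = v.length by ring,
          show (s : ℤ) + r + (degree v - s) = r + degree v by ring] at this
      · have := L_mul (gen_mem_L (t := t) i j s)
          (L_mul (hdx' i j s) (word_mem_L (t := t) (le_refl (degree v))))
        exact L_le_W (by omega) _ this
      · have := W_mul (gen_mem_W (t := t) i j s) (hprod i j s)
        rw [show (s : ℤ) + (r + degree v - s) = r + degree v by ring] at this
        exact W_mono (by omega) _ this
    have hsum := Submodule.sum_mem (W t v.length (r + degree v)) (t := Finset.univ) fun i _ =>
      Submodule.sum_mem _ (t := Finset.univ) fun j _ =>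
        Submodule.sum_mem _ (t := Finset.range N) fun s _ => key i j s
    simp only [Finset.sum_sub_distrib, Finset.sum_add_distrib] at hsum
    rw [hX] at hsum
    simp only [← Finset.mul_sum] at hsum
    have ihm := W_mul hgW (ih (by omega))
    rw [show (1 : ℤ) + (v.length - 1) = v.length by ring] at ihm
    have := Submodule.add_mem _ hsum ihm
    convert this using 1
    simp only [euler, mul_sub, List.length_cons, Nat.cast_add, Nat.cast_one, add_smul, one_smul,
      mul_smul_comm]
    abel

theorem euler_sub_mem (ht : IsRTTFamily t) (hΔ : IsEval t Δ) {q : ℕ} {l : ℤ} {y : A} {N : ℕ}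
    (hN : l < N) (hy : y ∈ W t q l) :
    euler t Δ N y - (q : ℂ) • y ∈ W t (q - 1) l := by
  induction hy using Submodule.span_induction with
  | mem x hx =>
    obtain ⟨v, hv, rfl⟩ := hx
    have hvN : degree v < N := by rcases hv with hv | hv <;> omega
    have h := euler_word ht hΔ v hvN
    by_cases hq : degree v = l ∧ v.length = q
    · rw [← hq.1, ← hq.2]; exact h
    · have hword : word t v ∈ W t (q - 1) l := by
        refine Submodule.subset_span ⟨v, ?_, rfl⟩
        simp only [Set.mem_ofPred_eq] at hv ⊢
        omega
      have h' : euler t Δ N (word t v) - (v.length : ℂ) • word t v ∈ W t (q - 1) l := by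
        rcases hv with hv | hv
        · exact L_le_W hv _ (W_le_L _ _ h)
        · rw [← hv.1]
          exact W_mono (by omega) _ h
      have e := Submodule.add_mem _ h' (Submodule.smul_mem _ ((v.length : ℂ) - q) hword)
      rwa [sub_smul, sub_add_sub_cancel] at e
  | zero => simp [euler, diff_zero]
  | add x y _ _ hx hy =>
    have := Submodule.add_mem _ hx hy
    rwa [sub_add_sub_comm, ← euler_add, ← smul_add] at this
  | smul c x _ hx =>
    have := Submodule.smul_mem _ c hx
    rwa [smul_sub, ← euler_smul, smul_comm c] at this

end LoopFiltration

namespace LoopFiltration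

variable {A : Type*} [Ring A] [Algebra ℂ A] {n : ℕ} {t : Fin n → Fin n → ℕ → A}
  {Δ : A →ₐ[ℂ] Matrix (Fin n) (Fin n) (Polynomial A)}

/-! ### Elements which commute with the high modes up to lower terms -/

/-- The element `y` of loop degree at most `l` commutes with `t_{h,k}^{(M+1)}`, `M` large, up to
terms of lower loop degree. -/
def AlmostCentral (t : Fin n → Fin n → ℕ → A) (l : ℤ) (y : A) : Prop :=
  y ∈ L t l ∧ ∃ K : ℕ, ∀ M : ℕ, K ≤ M → ∀ h k,
    y * t h k (M + 1) - t h k (M + 1) * y ∈ L t (l + M - 1)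

/-- Apply `Δ` to the commutator of `y` with a high mode. The image of the mode is the mode itself
plus `e_{h,k} x^M` plus a remainder, whose products with `Δ(y)` have loop degree too low to matter.
-/
theorem AlmostCentral.commutator_mem (ht : IsRTTFamily t) (hΔ : IsEval t Δ) {l : ℤ} {y : A}
    (hy : AlmostCentral t l y) : ∃ K : ℕ, ∀ M : ℕ, K ≤ M → ∀ h k a b (s : ℕ),
      (Δ y a b).coeff s * t h k (M + 1) - t h k (M + 1) * (Δ y a b).coeff s
        + ((if k = b then (Δ y a h * Polynomial.X ^ M).coeff s else 0)
        - (if h = a then (Polynomial.X ^ M * Δ y k b).coeff s else 0)) ∈ L t (l + M - 1 - s) := by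
  obtain ⟨hyl, K, hK⟩ := hy
  refine ⟨K, fun M hM h k a b s => ?_⟩
  set τ := t h k (M + 1) with hτ
  set X₀ : Matrix (Fin n) (Fin n) (Polynomial A) := Matrix.single h k (Polynomial.X ^ M) with hX₀
  set R := diff Δ τ - X₀ with hR
  have hRm : R ∈ matFil (L t) (M - 1) := diff_gen_sub_mem ht hΔ h k M
  have hτΔ : Δ τ = const n τ + X₀ + R := by
    rw [hR, eval_eq_diff_add]; abel
  have hZ := eval_mem_L ht hΔ hyl
  have mulL : ∀ l m a b, a ∈ L t l → b ∈ L t m → a * b ∈ L t (l + m) := fun l m a b => L_mul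
  have h1 := eval_mem_L ht hΔ (hK M hM h k)
  rw [map_sub, map_mul, map_mul, ← hτ, hτΔ] at h1
  have h2 := matFil_mul mulL hZ hRm
  have h3 := matFil_mul mulL hRm hZ
  rw [show l + ((M : ℤ) - 1) = l + M - 1 by ring] at h2
  rw [show ((M : ℤ) - 1) + l = l + M - 1 by ring] at h3
  have h4 := Submodule.add_mem _ (Submodule.sub_mem _ h1 h2) h3
  have e : Δ y * (const n τ + X₀ + R) - (const n τ + X₀ + R) * Δ y - Δ y * R + R * Δ y =
      Δ y * const n τ - const n τ * Δ y + (Δ y * X₀ - X₀ * Δ y) := by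
    simp only [mul_add, add_mul]; abel
  rw [e] at h4
  have h5 := h4 a b s
  rw [Matrix.add_apply, Matrix.sub_apply, Matrix.sub_apply, Polynomial.coeff_add,
    Polynomial.coeff_sub, Polynomial.coeff_sub, mul_const_apply, const_mul_apply] at h5
  have e1 : (Δ y * X₀) a b = if k = b then Δ y a h * Polynomial.X ^ M else 0 := by
    split_ifs with hkb
    · subst hkb; simp [hX₀]
    · exact Matrix.mul_single_apply_of_ne _ _ _ _ _ (Ne.symm hkb) _
  have e2 : (X₀ * Δ y) a b = if h = a then Polynomial.X ^ M * Δ y k b else 0 := by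
    split_ifs with hha
    · subst hha; simp [hX₀]
    · exact Matrix.single_mul_apply_of_ne _ _ _ _ _ (Ne.symm hha) _
  rw [e1, e2] at h5
  convert h5 using 3 <;> split_ifs <;> simp

/-- The partial derivatives of an almost central element are almost central. -/
theorem AlmostCentral.diff_coeff (ht : IsRTTFamily t) (hΔ : IsEval t Δ) {l : ℤ} {y : A}
    (hy : AlmostCentral t l y) (a b : Fin n) (s : ℕ) :
    AlmostCentral t (l - s) ((diff Δ y a b).coeff s) := by
  refine ⟨diff_mem_L ht hΔ hy.1 a b s, ?_⟩
  obtain ⟨K, hK⟩ := hy.commutator_mem ht hΔ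
  obtain ⟨K', hK'⟩ := hy.2
  -- For `M > s` the terms multiplied by `x^M` do not reach the coefficient of `x^s`, so only
  -- commutators with the mode remain.
  refine ⟨max (max K K') (s + 1), fun M hM h k => ?_⟩
  have hM1 : K ≤ M := by omega
  have hM2 : K' ≤ M := by omega
  have hM3 : s < M := by omega
  have h1 := hK M hM1 h k a b s
  rw [Polynomial.coeff_mul_X_pow', Polynomial.coeff_X_pow_mul', if_neg (not_le.2 hM3),
    if_neg (not_le.2 hM3), ite_self, ite_self, sub_zero, add_zero] at h1
  have h2 := hK' M hM2 h k
  rw [diff, Matrix.sub_apply, Polynomial.coeff_sub, const_apply_coeff]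
  rw [show l - s + M - 1 = l + M - 1 - s by ring]
  split_ifs with hab
  · rw [hab.2] at h1 ⊢
    have := Submodule.sub_mem _ h1 (L_mono (by simp) h2)
    convert this using 1
    simp only [sub_mul, mul_sub]
    abel
  · simpa using h1

/-- In the coefficient of `x^{s+M}` with `M` large only the commutator of `Δ(y)` with `e_{h,k} x^M`
survives. Hence `Δ(y)` is a scalar matrix to leading order. -/
theorem AlmostCentral.coeff_rel (ht : IsRTTFamily t) (hΔ : IsEval t Δ) {l : ℤ} {y : A}
    (hy : AlmostCentral t l y) (h k a b : Fin n) (s : ℕ) :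
    (if k = b then (Δ y a h).coeff s else 0) - (if h = a then (Δ y k b).coeff s else 0) ∈
      L t (l - s - 1) := by
  obtain ⟨K, hK⟩ := hy.commutator_mem ht hΔ
  -- With `M > l` the coefficient of `x^{s+M}` in `Δ(y)` would have negative loop degree, so it
  -- vanishes.
  set M := max K (l + 1).toNat with hMdef
  have hM : l < M := by omega
  have h1 := hK M (le_max_left _ _) h k a b (s + M)
  have h2 : (Δ y a b).coeff (s + M) = 0 := by
    have := eval_mem_L ht hΔ hy.1 a b (s + M)
    rwa [L_eq_bot (by push_cast; omega), Submodule.mem_bot] at this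
  rw [h2, Polynomial.coeff_mul_X_pow, Polynomial.coeff_X_pow_mul, zero_mul, mul_zero,
    sub_zero, zero_add] at h1
  rwa [show l + M - 1 - ((s + M : ℕ) : ℤ) = l - s - 1 by push_cast; ring] at h1

theorem AlmostCentral.diff_offDiag (ht : IsRTTFamily t) (hΔ : IsEval t Δ) {l : ℤ} {y : A}
    (hy : AlmostCentral t l y) {a b : Fin n} (hab : a ≠ b) (s : ℕ) :
    (diff Δ y a b).coeff s ∈ L t (l - s - 1) := by
  have := hy.coeff_rel ht hΔ b b a b s
  rw [if_pos rfl, if_neg hab.symm, sub_zero] at this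
  rw [diff, Matrix.sub_apply, Polynomial.coeff_sub, const_apply_coeff, if_neg (by tauto), sub_zero]
  exact this

theorem AlmostCentral.diff_diag (ht : IsRTTFamily t) (hΔ : IsEval t Δ) {l : ℤ} {y : A}
    (hy : AlmostCentral t l y) (a b : Fin n) (s : ℕ) :
    (diff Δ y a a).coeff s - (diff Δ y b b).coeff s ∈ L t (l - s - 1) := by
  have := hy.coeff_rel ht hΔ a b a b s
  rw [if_pos rfl, if_pos rfl] at this
  simp only [diff, Matrix.sub_apply, Polynomial.coeff_sub, const_apply_coeff, true_and]
  rwa [sub_sub_sub_cancel_right]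

/-! ### The center -/

section Center

variable {c : ℕ → A}

/-- To leading order the matrix of derivatives is scalar, so the Euler sum reduces to traces `∑
t_{i,i}^{(s+1)}`, and these are the leading terms of `c s`. -/
theorem AlmostCentral.euler_sub_mem (ht : IsRTTFamily t) (hΔ : IsEval t Δ) (i₀ : Fin n)
    (hc : ∀ r : ℕ, c r - ∑ i, t i i (r + 1) ∈ L t ((r : ℤ) - 1)) {l : ℤ} {y : A}
    (hy : AlmostCentral t l y) (N : ℕ) :
    euler t Δ N y - ∑ s ∈ Finset.range N, c s * (diff Δ y i₀ i₀).coeff s ∈ L t (l - 1) := by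
  have e : euler t Δ N y - ∑ s ∈ Finset.range N, c s * (diff Δ y i₀ i₀).coeff s =
      (∑ i, ∑ j, ∑ s ∈ Finset.range N, t i j (s + 1) * ((diff Δ y i j).coeff s -
        if i = j then (diff Δ y i₀ i₀).coeff s else 0)) -
      ∑ s ∈ Finset.range N, (c s - ∑ i, t i i (s + 1)) * (diff Δ y i₀ i₀).coeff s := by
    have e1 : ∑ i, ∑ j, ∑ s ∈ Finset.range N,
        t i j (s + 1) * (if i = j then (diff Δ y i₀ i₀).coeff s else 0) =
        ∑ s ∈ Finset.range N, (∑ i, t i i (s + 1)) * (diff Δ y i₀ i₀).coeff s := by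
      simp only [Finset.sum_mul]
      rw [Finset.sum_comm (s := Finset.range N)]
      refine Finset.sum_congr rfl fun i _ => ?_
      rw [Finset.sum_comm]
      simp
    simp only [mul_sub, Finset.sum_sub_distrib, sub_mul]
    rw [e1, euler]
    abel
  rw [e]
  refine Submodule.sub_mem _ ?_ ?_
  · refine Submodule.sum_mem _ fun i _ => Submodule.sum_mem _ fun j _ =>
      Submodule.sum_mem _ fun s _ => ?_
    have : (diff Δ y i j).coeff s - (if i = j then (diff Δ y i₀ i₀).coeff s else 0) ∈
        L t (l - s - 1) := by
      split_ifs with hij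
      · subst hij; exact hy.diff_diag ht hΔ i i₀ s
      · rw [sub_zero]; exact hy.diff_offDiag ht hΔ hij s
    have := L_mul (gen_mem_L (t := t) i j s) this
    rwa [show (s : ℤ) + (l - s - 1) = l - 1 by ring] at this
  · refine Submodule.sum_mem _ fun s _ => ?_
    have := L_mul (hc s) (diff_mem_L ht hΔ hy.1 i₀ i₀ s)
    rwa [show (s : ℤ) - 1 + (l - s) = l - 1 by ring] at this

/-- Induction on the word length `q`. The derivatives of `y` have shorter words and are again almost
central, so they are polynomials in the `c s` to leading order, and Euler's formula recovers `y`
from them. Exact centrality would not pass to the derivatives, which is why the weaker property is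
used. -/
theorem exists_adjoin_of_almostCentral (ht : IsRTTFamily t) (hΔ : IsEval t Δ) (i₀ : Fin n)
    (hcen : ∀ r y, c r * y = y * c r)
    (hc : ∀ r : ℕ, c r - ∑ i, t i i (r + 1) ∈ L t ((r : ℤ) - 1)) (q : ℕ) :
    ∀ (l : ℤ) (y : A), y ∈ W t q l → AlmostCentral t l y →
      ∃ P ∈ Algebra.adjoin ℂ (Set.range c), y - P ∈ L t (l - 1) := by
  have hcenP : ∀ P ∈ Algebra.adjoin ℂ (Set.range c), ∀ y, P * y = y * P := by
    intro P hP y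
    have : Algebra.adjoin ℂ (Set.range c) ≤ Subalgebra.centralizer ℂ {y} := by
      rw [Algebra.adjoin_le_iff]
      rintro _ ⟨r, rfl⟩
      refine (Subalgebra.mem_centralizer_iff ℂ).2 fun g hg => ?_
      rw [Set.mem_singleton_iff.1 hg]
      exact (hcen r y).symm
    exact ((Subalgebra.mem_centralizer_iff ℂ).1 (this hP) y rfl).symm
  have hcL : ∀ s : ℕ, c s ∈ L t s := by
    intro s
    rw [← sub_add_cancel (c s) (∑ i, t i i (s + 1))]
    exact Submodule.add_mem _ (L_mono (by omega) (hc s))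
      (Submodule.sum_mem _ fun i _ => gen_mem_L i i s)
  induction q with
  | zero =>
    intro l y hy hyc
    clear hyc
    induction hy using Submodule.span_induction with
    | mem x hx =>
      obtain ⟨v, hv, rfl⟩ := hx
      rcases hv with hv | hv
      · exact ⟨0, Subalgebra.zero_mem _, by rw [sub_zero]; exact word_mem_L (by omega)⟩
      · have : v = [] := List.length_eq_zero_iff.1 (by omega)
        subst this
        refine ⟨1, Subalgebra.one_mem _, ?_⟩
        have : word t ([] : List (Fin n × Fin n × ℕ)) = 1 := rfl
        rw [this, sub_self]
        exact Submodule.zero_mem _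
    | zero => exact ⟨0, Subalgebra.zero_mem _, by simp⟩
    | add x y _ _ hx hy =>
      obtain ⟨P, hP, hP'⟩ := hx
      obtain ⟨Q, hQ, hQ'⟩ := hy
      refine ⟨P + Q, Subalgebra.add_mem _ hP hQ, ?_⟩
      rw [add_sub_add_comm]
      exact Submodule.add_mem _ hP' hQ'
    | smul a x _ hx =>
      obtain ⟨P, hP, hP'⟩ := hx
      refine ⟨a • P, Subalgebra.smul_mem _ hP a, ?_⟩
      rw [← smul_sub]
      exact Submodule.smul_mem _ a hP'
  | succ q ih =>
    intro l y hy hyc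
    set N := (l + 1).toNat with hNdef
    have hN : l < N := by omega
    have hd : ∀ s : ℕ, ∃ P ∈ Algebra.adjoin ℂ (Set.range c),
        (diff Δ y i₀ i₀).coeff s - P ∈ L t (l - s - 1) := by
      intro s
      refine ih (l - s) _ ?_ (hyc.diff_coeff ht hΔ i₀ i₀ s)
      have := diff_mem_W ht hΔ hy i₀ i₀ s
      rwa [Nat.cast_succ, add_sub_cancel_right] at this
    choose P hP hP' using hd
    have h1 := LoopFiltration.euler_sub_mem ht hΔ hN hy
    have h2 := hyc.euler_sub_mem ht hΔ i₀ hc N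
    set Q := ∑ s ∈ Finset.range N, c s * P s with hQ
    have hQm : Q ∈ Algebra.adjoin ℂ (Set.range c) :=
      Subalgebra.sum_mem _ fun s _ =>
        Subalgebra.mul_mem _ (Algebra.subset_adjoin ⟨s, rfl⟩) (hP s)
    have h3 : ∑ s ∈ Finset.range N, c s * (diff Δ y i₀ i₀).coeff s - Q ∈ L t (l - 1) := by
      rw [hQ, ← Finset.sum_sub_distrib]
      refine Submodule.sum_mem _ fun s _ => ?_
      rw [← mul_sub]
      have := L_mul (hcL s) (hP' s)
      rwa [show (s : ℤ) + (l - s - 1) = l - 1 by ring] at this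
    rw [Nat.cast_succ, add_sub_cancel_right] at h1
    have h4 : ((q + 1 : ℕ) : ℂ) • y - Q ∈ W t q l := by
      have := Submodule.sub_mem _ (L_le_W (q := q) (by omega : l - 1 < l)
        (Submodule.add_mem _ h2 h3)) h1
      convert this using 1
      abel
    have hq0 : ((q + 1 : ℕ) : ℂ) ≠ 0 := Nat.cast_ne_zero.2 (Nat.succ_ne_zero q)
    have h5 : y - ((q + 1 : ℕ) : ℂ)⁻¹ • Q ∈ W t q l := by
      have := Submodule.smul_mem _ ((q + 1 : ℕ) : ℂ)⁻¹ h4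
      rwa [smul_sub, smul_smul, inv_mul_cancel₀ hq0, one_smul] at this
    have hQm' : ((q + 1 : ℕ) : ℂ)⁻¹ • Q ∈ Algebra.adjoin ℂ (Set.range c) :=
      Subalgebra.smul_mem _ hQm _
    -- Subtracting the central element `Q / (q + 1)` leaves all commutators unchanged, so the
    -- shorter remainder is still almost central.
    obtain ⟨P', hP1, hP2⟩ := ih l _ h5 ⟨W_le_L _ _ h5, by
      obtain ⟨K, hK⟩ := hyc.2
      refine ⟨K, fun M hM h k => ?_⟩
      have := hK M hM h k
      rwa [sub_mul, mul_sub, hcenP _ hQm', sub_sub_sub_cancel_right]⟩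
    refine ⟨((q + 1 : ℕ) : ℂ)⁻¹ • Q + P', Subalgebra.add_mem _ hQm' hP1, ?_⟩
    rwa [← sub_sub]

/-- Subtracting a polynomial in the central `c r` keeps a central element central and lowers its
loop degree; there is nothing in negative degree. -/
theorem center_le_adjoin (ht : IsRTTFamily t) (hΔ : IsEval t Δ) (i₀ : Fin n)
    (hgen : ∀ Z : Subalgebra ℂ A, (∀ i j r, t i j r ∈ Z) → Z = ⊤)
    (hcen : ∀ r, c r ∈ Subalgebra.center ℂ A)
    (hc : ∀ r : ℕ, c r - ∑ i, t i i (r + 1) ∈ L t ((r : ℤ) - 1)) :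
    Subalgebra.center ℂ A ≤ Algebra.adjoin ℂ (Set.range c) := by
  have hle : Algebra.adjoin ℂ (Set.range c) ≤ Subalgebra.center ℂ A := by
    rw [Algebra.adjoin_le_iff]
    rintro _ ⟨r, rfl⟩
    exact hcen r
  have key : ∀ (m : ℕ) (z : A), z ∈ Subalgebra.center ℂ A → z ∈ L t ((m : ℤ) - 1) →
      z ∈ Algebra.adjoin ℂ (Set.range c) := by
    intro m
    induction m with
    | zero =>
      intro z _ hz
      rw [L_eq_bot (by simp), Submodule.mem_bot] at hz
      rw [hz]
      exact Subalgebra.zero_mem _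
    | succ m ih =>
      intro z hz hzL
      obtain ⟨q, hq⟩ := exists_mem_W hzL
      obtain ⟨P, hP, hzP⟩ := exists_adjoin_of_almostCentral ht hΔ i₀
        (fun r y => ((Subalgebra.mem_center_iff.1 (hcen r)) y).symm) hc q _ z hq
        ⟨hzL, 0, fun M _ h k => by
          rw [Subalgebra.mem_center_iff.1 hz, sub_self]; exact Submodule.zero_mem _⟩
      have := ih (z - P) (Subalgebra.sub_mem _ hz (hle hP)) (by simpa using hzP)
      simpa using Subalgebra.add_mem _ this hP
  intro z hz
  obtain ⟨l, hl⟩ := exists_mem_L hgen ht.zero z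
  exact key (l + 1) z hz (by simpa using hl)

end Center

/-! ### Leading terms -/

/-- The power series whose `r`-th coefficient has loop degree at most `r - k`. -/
def seriesFil (t : Fin n → Fin n → ℕ → A) (k : ℤ) : AddSubgroup A⟦X⟧ where
  carrier := {f | ∀ r : ℕ, PowerSeries.coeff r f ∈ L t (r - k)}
  add_mem' hf hg r := by rw [map_add]; exact Submodule.add_mem _ (hf r) (hg r)
  zero_mem' r := by simp
  neg_mem' hf r := by rw [map_neg]; exact Submodule.neg_mem _ (hf r)

theorem seriesFil_mul {k m : ℤ} {f g : A⟦X⟧} (hf : f ∈ seriesFil t k) (hg : g ∈ seriesFil t m) :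
    f * g ∈ seriesFil t (k + m) := by
  intro r
  rw [PowerSeries.coeff_mul]
  refine Submodule.sum_mem _ fun p hp => ?_
  have := Finset.HasAntidiagonal.mem_antidiagonal.1 hp
  exact L_mono (by omega) (L_mul (hf p.1) (hg p.2))

theorem seriesFil_mono {k m : ℤ} (h : m ≤ k) : seriesFil t k ≤ seriesFil t m :=
  fun _ hf r => L_mono (by omega) (hf r)

theorem one_mem_seriesFil : (1 : A⟦X⟧) ∈ seriesFil t 0 := by
  intro r
  rw [PowerSeries.coeff_one]
  split_ifs with h
  · subst h; exact one_mem_L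
  · exact Submodule.zero_mem _

theorem invOfUnit_mem_seriesFil {f : A⟦X⟧} (hf : f ∈ seriesFil t 0) :
    PowerSeries.invOfUnit f 1 ∈ seriesFil t 0 := by
  intro r
  induction r using Nat.strong_induction_on with
  | _ r ih =>
    rw [PowerSeries.coeff_invOfUnit]
    split_ifs with hr
    · subst hr; simpa using one_mem_L
    · rw [inv_one, Units.val_one, neg_one_mul]
      refine Submodule.neg_mem _ (Submodule.sum_mem _ fun p hp => ?_)
      have := Finset.HasAntidiagonal.mem_antidiagonal.1 hp
      split_ifs with hlt
      · exact L_mono (by omega) (L_mul (hf p.1) (ih p.2 hlt))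
      · exact Submodule.zero_mem _

theorem seriesMatrix_sub_one_mem (ht : IsRTTFamily t) (i j : Fin n) :
    RTT.seriesMatrix t i j - (1 : Matrix (Fin n) (Fin n) A⟦X⟧) i j ∈ seriesFil t 1 := by
  rintro (_ | r)
  · rw [map_sub, RTT.seriesMatrix, Matrix.of_apply, PowerSeries.coeff_mk, ht.zero, Matrix.one_apply]
    split_ifs <;> simp
  · have : PowerSeries.coeff (r + 1) ((1 : Matrix (Fin n) (Fin n) A⟦X⟧) i j) = 0 := by
      rw [Matrix.one_apply]
      split_ifs <;> simp [PowerSeries.coeff_one]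
    rw [map_sub, RTT.seriesMatrix, Matrix.of_apply, PowerSeries.coeff_mk, this, sub_zero]
    exact gen_mem_L_sub_one i j (Nat.succ_pos r)

/-- Each correction contains two off-diagonal entries, and every such entry lies one step down in
the filtration. -/
theorem gaussElim_sub_mem (ht : IsRTTFamily t) (k : ℕ) (hk : k ≤ n) (i j : Fin n)
    (hi : k ≤ i) (hj : k ≤ j) :
    gaussElim (RTT.seriesMatrix t) k i j - RTT.seriesMatrix t i j ∈ seriesFil t 2 := by
  induction k generalizing i j with
  | zero =>
    have : gaussElim (RTT.seriesMatrix t) 0 i j = RTT.seriesMatrix t i j := rfl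
    rw [this, sub_self]
    exact AddSubgroup.zero_mem _
  | succ k ih =>
    set M := RTT.seriesMatrix t with hM
    set p : Fin n := ⟨k, hk⟩ with hp
    have e : gaussElim M (k + 1) i j = gaussElim M k i j
      - gaussElim M k i p * PowerSeries.invOfUnit (gaussElim M k p p) 1 * gaussElim M k p j :=
      gaussElim_succ p i j
    have ih' := fun i j hi hj => ih (by omega) i j hi hj
    have one : ∀ i j : Fin n, k ≤ i → k ≤ j →
        gaussElim M k i j - (1 : Matrix (Fin n) (Fin n) A⟦X⟧) i j ∈ seriesFil t 1 := by
      intro i j hi hj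
      have := AddSubgroup.add_mem _ (seriesFil_mono (by norm_num) (ih' i j hi hj))
        (seriesMatrix_sub_one_mem ht i j)
      rwa [sub_add_sub_cancel] at this
    have hip : i ≠ p := fun h => by rw [h] at hi; exact absurd hi (Nat.not_succ_le_self k)
    have hpj : p ≠ j := fun h => by rw [← h] at hj; exact absurd hj (Nat.not_succ_le_self k)
    have a1 := one i p (by omega) le_rfl
    have a2 := one p j le_rfl (by omega)
    have a3 := one p p le_rfl le_rfl
    rw [Matrix.one_apply_ne hip, sub_zero] at a1
    rw [Matrix.one_apply_ne hpj, sub_zero] at a2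
    rw [Matrix.one_apply_eq] at a3
    have a4 : gaussElim M k p p ∈ seriesFil t 0 := by
      have := AddSubgroup.add_mem _ (seriesFil_mono (show (0 : ℤ) ≤ 1 by norm_num) a3)
        one_mem_seriesFil
      rwa [sub_add_cancel] at this
    rw [e, sub_right_comm]
    refine AddSubgroup.sub_mem _ (ih' i j (by omega) (by omega)) ?_
    have := seriesFil_mul (seriesFil_mul a1 (invOfUnit_mem_seriesFil a4)) a2
    norm_num at this
    exact this

/-- The coefficient of `u^{-r}` in `f(u - c)` is `f_r` plus a combination of the `f_s` with `s < r`.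
-/
theorem shift_sub_mem {k : ℤ} {f : A⟦X⟧} (hf : f ∈ seriesFil t k) (c : ℂ) :
    Yangian.shift c f - f ∈ seriesFil t (k + 1) := by
  intro r
  rw [map_sub, Yangian.coeff_shift, Finset.sum_range_succ, Yangian.coeff_shiftVar_pow_self,
    one_smul, add_sub_cancel_right]
  refine Submodule.sum_mem _ fun s hs => Submodule.smul_mem _ _ (L_mono ?_ (hf s))
  have := Finset.mem_range.1 hs
  omega

theorem ofFn_prod_sub_mem {m : ℕ} (g : Fin m → A⟦X⟧) (hg : ∀ i, g i - 1 ∈ seriesFil t 1) :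
    (List.ofFn g).prod - 1 ∈ seriesFil t 1 ∧
      (List.ofFn g).prod - 1 - ∑ i, (g i - 1) ∈ seriesFil t 2 := by
  induction m with
  | zero => simp
  | succ m ih =>
    obtain ⟨h1, h2⟩ := ih (fun i => g i.succ) (fun i => hg _)
    rw [List.ofFn_succ, List.prod_cons, Fin.sum_univ_succ]
    set Q := (List.ofFn fun i => g i.succ).prod
    have h3 := seriesFil_mul (hg 0) h1
    norm_num at h3
    constructor
    · have := AddSubgroup.add_mem _ (AddSubgroup.add_mem _ (hg 0) h1)
        (seriesFil_mono (show (1 : ℤ) ≤ 2 by norm_num) h3)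
      convert this using 1
      noncomm_ring
    · have := AddSubgroup.add_mem _ h2 h3
      convert this using 1
      noncomm_ring

end LoopFiltration

namespace Yangian

open LoopFiltration

/-- Elimination, shifting and the nonlinear terms of the product of Gauss factors all contribute
only to `seriesFil` at level `2`. What remains in leading degree is the trace of `T(u)`. -/
theorem C_sub_mem (n r : ℕ) :
    C n (r + 1) - ∑ i, T n i i (r + 1) ∈ L (T n) ((r : ℤ) - 1) := by
  have ht := isRTTFamily_T n
  have hD : ∀ i, D n i = gaussElim (RTT.seriesMatrix (T n)) i i i := fun _ => rfl
  have hT := fun i => seriesMatrix_sub_one_mem ht i i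
  simp only [Matrix.one_apply_eq] at hT
  have hDT : ∀ i, D n i - RTT.seriesMatrix (T n) i i ∈ seriesFil (T n) 2 := fun i =>
    gaussElim_sub_mem ht i i.2.le i i le_rfl le_rfl
  have hD1 : ∀ i, D n i - 1 ∈ seriesFil (T n) 1 := by
    intro i
    have := AddSubgroup.add_mem _ (seriesFil_mono (show (1 : ℤ) ≤ 2 by norm_num) (hDT i)) (hT i)
    rwa [sub_add_sub_cancel] at this
  have hs : ∀ i : Fin n, shift ((i : ℕ) : ℂ) (D n i) - D n i ∈ seriesFil (T n) 2 := by
    intro i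
    have := shift_sub_mem (hD1 i) ((i : ℕ) : ℂ)
    rw [← shiftHom_apply, map_sub, map_one, sub_sub_sub_cancel_right, shiftHom_apply] at this
    norm_num at this
    exact this
  have hsT : ∀ i : Fin n, shift ((i : ℕ) : ℂ) (D n i) - RTT.seriesMatrix (T n) i i ∈
      seriesFil (T n) 2 := by
    intro i
    have := AddSubgroup.add_mem _ (hs i) (hDT i)
    rwa [sub_add_sub_cancel] at this
  have hs1 : ∀ i : Fin n, shift ((i : ℕ) : ℂ) (D n i) - 1 ∈ seriesFil (T n) 1 := by
    intro i
    have := AddSubgroup.add_mem _ (seriesFil_mono (show (1 : ℤ) ≤ 2 by norm_num) (hsT i)) (hT i)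
    rwa [sub_add_sub_cancel] at this
  have h1 := (ofFn_prod_sub_mem _ hs1).2
  have h2 := AddSubgroup.sum_mem (seriesFil (T n) 2) (t := Finset.univ) fun i _ => hsT i
  have h3 := AddSubgroup.add_mem _ h1 h2 (r + 1)
  have e : PowerSeries.coeff (r + 1) ((List.ofFn fun i : Fin n => shift ((i : ℕ) : ℂ) (D n i)).prod
      - 1 - ∑ i : Fin n, (shift ((i : ℕ) : ℂ) (D n i) - 1) +
      ∑ i : Fin n, (shift ((i : ℕ) : ℂ) (D n i) - RTT.seriesMatrix (T n) i i)) =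
      C n (r + 1) - ∑ i, T n i i (r + 1) := by
    simp only [Finset.sum_sub_distrib, map_sub, map_add, map_sum, RTT.seriesMatrix,
      Matrix.of_apply, PowerSeries.coeff_mk, PowerSeries.coeff_one, Nat.succ_ne_zero, if_false,
      Finset.sum_const_zero]
    rw [C, CSeries]
    abel
  rw [e] at h3
  rwa [show ((r + 1 : ℕ) : ℤ) - 2 = r - 1 by push_cast; ring] at h3

theorem center_eq_adjoin (n : ℕ) (hn : 1 ≤ n) :
    Algebra.adjoin ℂ (Set.range fun r : ℕ => C n (r + 1)) = Subalgebra.center ℂ (Yangian n) := by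
  obtain ⟨Δ, hΔ⟩ := exists_evalCoproduct n
  refine le_antisymm ?_ ?_
  · rw [Algebra.adjoin_le_iff]
    rintro _ ⟨r, rfl⟩
    exact C_mem_center n (r + 1)
  · exact center_le_adjoin (isRTTFamily_T n) hΔ ⟨0, hn⟩ induction_T
      (fun r => C_mem_center n (r + 1)) (C_sub_mem n)

end Yangian

/-! ### Algebraic independence -/

section Products

variable {R ι : Type*} [CommRing R]

theorem PowerSeries.coeff_mul_of_X_pow_dvd {m : ℕ} {u : R⟦X⟧} (hu : (PowerSeries.X : R⟦X⟧) ^ m ∣ u)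
    (v : R⟦X⟧) : PowerSeries.coeff m (u * v) =
      PowerSeries.coeff m u * PowerSeries.constantCoeff v := by
  obtain ⟨w, rfl⟩ := hu
  rw [mul_assoc, PowerSeries.coeff_X_pow_mul', PowerSeries.coeff_X_pow_mul', if_pos le_rfl,
    if_pos le_rfl, Nat.sub_self, PowerSeries.coeff_zero_eq_constantCoeff_apply,
    PowerSeries.coeff_zero_eq_constantCoeff_apply, map_mul]

/-- Replacing one factor at a time, all other factors have constant term `1` and do not affect the
coefficient of `X^m`. -/
theorem PowerSeries.prod_sub_prod {m : ℕ} (s : Finset ι) (a b : ι → R⟦X⟧)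
    (ha : ∀ i, PowerSeries.constantCoeff (a i) = 1) (hb : ∀ i, PowerSeries.constantCoeff (b i) = 1)
    (hab : ∀ i, (PowerSeries.X : R⟦X⟧) ^ m ∣ a i - b i) :
    (PowerSeries.X : R⟦X⟧) ^ m ∣ ∏ i ∈ s, a i - ∏ i ∈ s, b i ∧
      PowerSeries.coeff m (∏ i ∈ s, a i - ∏ i ∈ s, b i) =
        ∑ i ∈ s, PowerSeries.coeff m (a i - b i) := by
  classical
  induction s using Finset.induction_on with
  | empty => simp
  | insert i s hi ih =>
    obtain ⟨h1, h2⟩ := ih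
    rw [Finset.prod_insert hi, Finset.prod_insert hi, Finset.sum_insert hi]
    have e : a i * ∏ i ∈ s, a i - b i * ∏ i ∈ s, b i =
        (a i - b i) * ∏ i ∈ s, a i + (∏ i ∈ s, a i - ∏ i ∈ s, b i) * b i := by ring
    rw [e]
    refine ⟨dvd_add (Dvd.dvd.mul_right (hab i) _) (Dvd.dvd.mul_right h1 _), ?_⟩
    rw [map_add, PowerSeries.coeff_mul_of_X_pow_dvd (hab i), PowerSeries.coeff_mul_of_X_pow_dvd h1,
      hb, h2, map_prod, Finset.prod_congr rfl fun i _ => ha i]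
    simp

end Products

namespace Yangian

section Shift

variable {A B : Type*} [Ring A] [Algebra ℂ A] [Ring B] [Algebra ℂ B]

theorem map_shift (f : A →ₐ[ℂ] B) (c : ℂ) (g : A⟦X⟧) :
    PowerSeries.map (f : A →+* B) (shift c g) = shift c (PowerSeries.map (f : A →+* B) g) := by
  ext m
  simp [coeff_shift]

theorem constantCoeff_shift (c : ℂ) (g : A⟦X⟧) :
    PowerSeries.constantCoeff (shift c g) = PowerSeries.constantCoeff g := by
  rw [← PowerSeries.coeff_zero_eq_constantCoeff_apply, coeff_shift]
  simp

theorem X_pow_dvd_shift {m : ℕ} (c : ℂ) {g : A⟦X⟧} (h : (PowerSeries.X : A⟦X⟧) ^ m ∣ g) :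
    (PowerSeries.X : A⟦X⟧) ^ m ∣ shift c g ∧
      PowerSeries.coeff m (shift c g) = PowerSeries.coeff m g := by
  rw [PowerSeries.X_pow_dvd_iff] at h ⊢
  refine ⟨fun k hk => ?_, ?_⟩
  · rw [coeff_shift]
    refine Finset.sum_eq_zero fun r hr => ?_
    rw [h r (by have := Finset.mem_range.1 hr; omega), smul_zero]
  · rw [coeff_shift, Finset.sum_range_succ, coeff_shiftVar_pow_self, one_smul, add_eq_right]
    refine Finset.sum_eq_zero fun r hr => ?_
    rw [h r (Finset.mem_range.1 hr), smul_zero]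

end Shift

/-! ### Solving `g(u) g(u - 1) ⋯ g(u - n + 1) = c(u)`, and characters of the Yangian. -/

section Solve

variable {R : Type*} [CommRing R] [Algebra ℂ R]

/-- The product `g(u) g(u - 1) ⋯ g(u - n + 1)`. -/
noncomputable def shiftProd (n : ℕ) (g : R⟦X⟧) : R⟦X⟧ := ∏ i : Fin n, shift ((i : ℕ) : ℂ) g

theorem shiftProd_sub {n m : ℕ} {g g' : R⟦X⟧} (hg : PowerSeries.constantCoeff g = 1)
    (hg' : PowerSeries.constantCoeff g' = 1) (h : (PowerSeries.X : R⟦X⟧) ^ m ∣ g - g') :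
    (PowerSeries.X : R⟦X⟧) ^ m ∣ shiftProd n g - shiftProd n g' ∧
      PowerSeries.coeff m (shiftProd n g - shiftProd n g') =
        (n : ℂ) • PowerSeries.coeff m (g - g') := by
  have hs : ∀ i : Fin n, shift ((i : ℕ) : ℂ) g - shift ((i : ℕ) : ℂ) g' =
      shift ((i : ℕ) : ℂ) (g - g') := fun i => (map_sub (shiftHom R _) g g').symm
  obtain ⟨h1, h2⟩ := PowerSeries.prod_sub_prod Finset.univ
    (fun i : Fin n => shift ((i : ℕ) : ℂ) g) (fun i : Fin n => shift ((i : ℕ) : ℂ) g')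
    (fun i => by rw [constantCoeff_shift, hg]) (fun i => by rw [constantCoeff_shift, hg'])
    (fun i => by rw [hs]; exact (X_pow_dvd_shift _ h).1)
  refine ⟨h1, h2.trans ?_⟩
  simp only [hs, (X_pow_dvd_shift _ h).2]
  rw [Finset.sum_const, Finset.card_univ, Fintype.card_fin, Nat.cast_smul_eq_nsmul]

theorem constantCoeff_shiftProd (n : ℕ) {g : R⟦X⟧} (hg : PowerSeries.constantCoeff g = 1) :
    PowerSeries.constantCoeff (shiftProd n g) = 1 := by
  rw [shiftProd, map_prod]
  exact Finset.prod_eq_one fun i _ => by rw [constantCoeff_shift, hg]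

/-- The equation `g(u) g(u - 1) ⋯ g(u - n + 1) = c(u)` is solvable. -/
theorem exists_shiftProd_eq {n : ℕ} (hn : n ≠ 0) {c : R⟦X⟧}
    (hc : PowerSeries.constantCoeff c = 1) :
    ∃ g : R⟦X⟧, PowerSeries.constantCoeff g = 1 ∧ shiftProd n g = c := by
  -- Successive approximation: adding `a X^{m+1}` to `g` changes the coefficient of `X^{m+1}` in the
  -- product by `n a` and no lower coefficient, so the error is divided by `n`.
  let G : ℕ → R⟦X⟧ := fun m => Nat.rec 1 (fun m g => g + PowerSeries.monomial (m + 1)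
    ((n : ℂ)⁻¹ • PowerSeries.coeff (m + 1) (c - shiftProd n g))) m
  have hG : ∀ m, G (m + 1) = G m + PowerSeries.monomial (m + 1)
    ((n : ℂ)⁻¹ • PowerSeries.coeff (m + 1) (c - shiftProd n (G m))) := fun m => rfl
  have hG1 : ∀ m, PowerSeries.constantCoeff (G m) = 1 := by
    intro m
    induction m with
    | zero => exact map_one _
    | succ m ih =>
      rw [hG, map_add, ih, ← PowerSeries.coeff_zero_eq_constantCoeff_apply,
        PowerSeries.coeff_monomial, if_neg (by omega), add_zero]
  have hmono : ∀ m, (PowerSeries.X : R⟦X⟧) ^ (m + 1) ∣ G (m + 1) - G m := by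
    intro m
    rw [hG, add_sub_cancel_left, PowerSeries.X_pow_dvd_iff]
    intro k hk
    rw [PowerSeries.coeff_monomial, if_neg (by omega)]
  have hstab : ∀ m k, m ≤ k → (PowerSeries.X : R⟦X⟧) ^ (m + 1) ∣ G k - G m := by
    intro m k hmk
    induction k, hmk using Nat.le_induction with
    | base => simp
    | succ k hmk ih =>
      rw [← sub_add_sub_cancel _ (G k)]
      exact dvd_add ((pow_dvd_pow _ (by omega)).trans (hmono k)) ih
  have happrox : ∀ m, (PowerSeries.X : R⟦X⟧) ^ (m + 1) ∣ c - shiftProd n (G m) := by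
    intro m
    induction m with
    | zero =>
      rw [zero_add, pow_one, PowerSeries.X_dvd_iff, map_sub, hc,
        constantCoeff_shiftProd n (hG1 0), sub_self]
    | succ m ih =>
      obtain ⟨h1, h2⟩ := shiftProd_sub (n := n) (hG1 (m + 1)) (hG1 m) (hmono m)
      rw [PowerSeries.X_pow_dvd_iff] at ih h1 ⊢
      intro k hk
      have e : c - shiftProd n (G (m + 1)) =
        (c - shiftProd n (G m)) - (shiftProd n (G (m + 1)) - shiftProd n (G m)) := by ring
      rw [e, map_sub]
      rcases Nat.lt_succ_iff_lt_or_eq.1 hk with hk | rfl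
      · rw [ih k hk, h1 k hk, sub_zero]
      · rw [h2, hG, add_sub_cancel_left, PowerSeries.coeff_monomial, if_pos rfl, smul_smul,
          mul_inv_cancel₀ (Nat.cast_ne_zero.2 hn), one_smul, sub_self]
  set g : R⟦X⟧ := PowerSeries.mk fun m => PowerSeries.coeff m (G m) with hg
  have hgG : ∀ m, (PowerSeries.X : R⟦X⟧) ^ (m + 1) ∣ g - G m := by
    intro m
    rw [PowerSeries.X_pow_dvd_iff]
    intro k hk
    have := PowerSeries.X_pow_dvd_iff.1 (hstab k m (by omega)) k (by omega)
    rw [map_sub, hg, PowerSeries.coeff_mk, ← neg_sub, ← map_sub, this, neg_zero]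
  have hg1 : PowerSeries.constantCoeff g = 1 := by
    have := PowerSeries.X_pow_dvd_iff.1 (hgG 0) 0 (by omega)
    rw [PowerSeries.coeff_zero_eq_constantCoeff_apply, map_sub, hG1, sub_eq_zero] at this
    exact this
  refine ⟨g, hg1, ?_⟩
  ext m
  have h1 := PowerSeries.X_pow_dvd_iff.1 (shiftProd_sub (n := n) hg1 (hG1 m) (hgG m)).1 m
    (Nat.lt_succ_self m)
  have h2 := PowerSeries.X_pow_dvd_iff.1 (happrox m) m (Nat.lt_succ_self m)
  rw [map_sub, sub_eq_zero] at h1 h2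
  rw [h1, h2]

end Solve

theorem gaussElim_of_offDiag_eq_zero {R : Type*} [Ring R] {n : ℕ}
    {M : Matrix (Fin n) (Fin n) R⟦X⟧} (hM : ∀ i j, i ≠ j → M i j = 0) (k : ℕ) (hk : k ≤ n)
    (i j : Fin n) (hi : k ≤ i) (hj : k ≤ j) : gaussElim M k i j = M i j := by
  induction k generalizing i j with
  | zero => rfl
  | succ k ih =>
    set p : Fin n := ⟨k, hk⟩ with hp
    have e : gaussElim M (k + 1) i j = gaussElim M k i j
      - gaussElim M k i p * PowerSeries.invOfUnit (gaussElim M k p p) 1 * gaussElim M k p j :=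
      gaussElim_succ p i j
    have hip : i ≠ p := fun h => by rw [h] at hi; exact absurd hi (Nat.not_succ_le_self k)
    rw [e, ih (by omega) i j (by omega) (by omega), ih (by omega) i p (by omega) le_rfl, hM i p hip,
      zero_mul, zero_mul, sub_zero]

/-- The character `T(u) ↦ g(u) · 1` of the Yangian maps `C_n(u)` to `g(u) g(u - 1) ⋯ g(u - n + 1)`. -/
theorem exists_character {R : Type*} [CommRing R] [Algebra ℂ R] {n : ℕ} {g : R⟦X⟧}
    (hg : PowerSeries.constantCoeff g = 1) :
    ∃ f : Yangian n →ₐ[ℂ] R, ∀ r, f (C n r) = PowerSeries.coeff r (shiftProd n g) := by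
  set t : Fin n → Fin n → ℕ → R := fun i j r => if i = j then PowerSeries.coeff r g else 0 with ht
  -- For a scalar matrix over a commutative ring both sides of the RTT relation vanish.
  have hfam : IsRTTFamily t := by
    refine ⟨fun i j => ?_, fun i j h k r s => ?_⟩
    · simp [ht, hg]
    · simp only [ht]
      split_ifs <;> ring
  obtain ⟨f, hf⟩ := exists_algHom hfam
  refine ⟨f, fun r => ?_⟩
  have hmap : (RTT.seriesMatrix (T n)).map (PowerSeries.map (f : Yangian n →+* R)) =
      RTT.seriesMatrix t := by
    ext i j r
    simp [RTT.seriesMatrix, hf]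
  have hD : ∀ i, PowerSeries.map (f : Yangian n →+* R) (D n i) = g := by
    intro i
    have h1 := map_gaussElim (f : Yangian n →+* R)
      (isRTTFamily_T n).constantCoeff_seriesMatrix i i.2.le i i
    rw [hmap, gaussElim_of_offDiag_eq_zero (M := RTT.seriesMatrix t) ?_ _ i.2.le _ _ le_rfl le_rfl] at h1
    · refine h1.trans ?_
      ext r
      simp [RTT.seriesMatrix, ht]
    · intro i j hij
      ext r
      simp [RTT.seriesMatrix, ht, hij]
  have hC : PowerSeries.map (f : Yangian n →+* R) (CSeries n) = shiftProd n g := by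
    rw [CSeries, map_list_prod, List.map_ofFn, shiftProd, ← List.prod_ofFn]
    congr 2
    funext i
    rw [Function.comp_apply, map_shift, hD]
  rw [← hC, PowerSeries.coeff_map]
  rfl

/-- A character with values in a polynomial ring sends `C_n^{(r+1)}` to the `r`-th variable;
independence of the images gives independence of the elements. -/
theorem algebraicIndependent_C {n : ℕ} (hn : n ≠ 0)
    (hC : ∀ r : ℕ, C n (r + 1) ∈ Subalgebra.center ℂ (Yangian n)) :
    AlgebraicIndependent ℂ
      (fun r : ℕ => (⟨C n (r + 1), hC r⟩ : Subalgebra.center ℂ (Yangian n))) := by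
  set c : (MvPolynomial ℕ ℂ)⟦X⟧ := PowerSeries.mk fun r => match r with
    | 0 => 1
    | r + 1 => MvPolynomial.X r with hc
  obtain ⟨g, hg, hgc⟩ := exists_shiftProd_eq (n := n) hn (c := c) (by
    rw [← PowerSeries.coeff_zero_eq_constantCoeff_apply, hc, PowerSeries.coeff_mk])
  obtain ⟨f, hf⟩ := exists_character (n := n) hg
  refine AlgebraicIndependent.of_comp (f.comp (Subalgebra.center ℂ (Yangian n)).val) ?_
  have : (f.comp (Subalgebra.center ℂ (Yangian n)).val) ∘
      (fun r : ℕ => (⟨C n (r + 1), hC r⟩ : Subalgebra.center ℂ (Yangian n))) =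
      (MvPolynomial.X : ℕ → MvPolynomial ℕ ℂ) := by
    funext r
    change f (C n (r + 1)) = _
    rw [hf, hgc, hc, PowerSeries.coeff_mk]
  rw [this]
  exact MvPolynomial.algebraicIndependent_X ℕ ℂ

end Yangian

/-- For `n ≥ 1`, the elements `C_n^{(1)}, C_n^{(2)}, …` are central, algebraically independent over
`ℂ` (in the commutative algebra `Z(Y_n)`), and generate the center `Z(Y_n)` as an algebra. -/
theorem theorem7p2 (n : ℕ) (hn : 1 ≤ n) :
    ∃ hC : ∀ r : ℕ, Yangian.C n (r + 1) ∈ Subalgebra.center ℂ (Yangian n),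
      AlgebraicIndependent ℂ
        (fun r : ℕ => (⟨Yangian.C n (r + 1), hC r⟩ : Subalgebra.center ℂ (Yangian n))) ∧
      Algebra.adjoin ℂ (Set.range fun r : ℕ => Yangian.C n (r + 1)) =
        Subalgebra.center ℂ (Yangian n) :=
  ⟨fun r => Yangian.C_mem_center n (r + 1),
    Yangian.algebraicIndependent_C (Nat.one_le_iff_ne_zero.1 hn) _, Yangian.center_eq_adjoin n hn⟩
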